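/- Let $\Lambda$ be an Artin algebra, i.e. a ring which is a finitely generated module over a commutative Artinian ring acting centrally on it, and let $\mathrm{mod}(\Lambda)$ be the class of finitely generated left $\Lambda$-modules. For $M\in\mathrm{mod}(\Lambda)$ let $\Omega M$ be the kernel of a projective cover of $M$, and $\Omega^n$ the $n$-fold iterate of $\Omega$. For $\mathcal{D}\subseteq\mathrm{mod}(\Lambda)$ let $\mathrm{add}\,\mathcal{D}$ be the class of direct summands of finite direct sums of modules in $\mathcal{D}$. A class $\mathcal{X}\subseteq\mathrm{mod}(\Lambda)$ is left saturated if it contains the finitely generated projective modules and is closed under extensions, kernels of epimorphisms between its objects, and direct summands. The dimension $\mathrm{resdim}_{\mathcal{X}}(M)$ is the least $k\ge 0$ such that there is an exact sequence $0\to X_k\to\cdots\to X_0\to M\to 0$ with all $X_i\in\mathcal{X}$ ($\infty$ if there is none), and $\mathrm{resdim}_{\mathcal{X}}(\mathcal{Y}):=\sup_{Y\in\mathcal{Y}}\mathrm{resdim}_{\mathcal{X}}(Y)$. Let $K_{\mathcal{P}}$ be the abelian group generated by the isomorphism classes $[M]$ of $M\in\mathrm{mod}(\Lambda)$ modulo the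 relations $[M]=[X]+[Y]$ if $M\cong X\oplus Y$ and $[P]=0$ if $P$ is projective, and let $L:K_{\mathcal{P}}\to K_{\mathcal{P}}$ be the endomorphism with $L[M]=[\Omega M]$. For $X\in\mathrm{mod}(\Lambda)$ let $\langle X\rangle\subseteq K_{\mathcal{P}}$ be the subgroup generated by all $[Y]$ with $Y\in\mathrm{add}\,X$, let $\Phi(X)$ be the least $k\ge 0$ such that $L:L^m\langle X\rangle\to L^{m+1}\langle X\rangle$ is an isomorphism for all $m\ge k$, and put $\Phi\dim(\mathcal{X}):=\sup_{X\in\mathcal{X}}\Phi(X)$. For $n\ge 0$, $V\in\mathrm{mod}(\Lambda)$ and $\mathcal{D}\subseteq\mathrm{mod}(\Lambda)$, the algebra $\Lambda$ is an $(n,V,\mathcal{D})$-LIT-algebra if $\mathrm{add}\,\mathcal{D}=\mathcal{D}$, $\Omega(\mathcal{D})\subseteq\mathcal{D}$, $\Phi\dim(\mathcal{D})=0$, and for each $M\in\mathrm{mod}(\Lambda)$ there is an exact sequence $0\to V_1\oplus D_1\to V_0\oplus D_0\to\Omega^nM\to 0$ with $V_0,V_1\in\mathrm{add}\,V$ and $D_0,D_1\in\mathcal{D}$.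 Finally, $\mathrm{fin.dim}(\Lambda)$ is the supremum of the finite projective dimensions of modules in $\mathrm{mod}(\Lambda)$. Let $n\ge 0$ be an integer. (1) If $\mathcal{X}\subseteq\mathrm{mod}(\Lambda)$ is left saturated with $\Phi\dim(\mathcal{X})=0$ and $\mathrm{resdim}_{\mathcal{X}}(\Omega^n(\mathrm{mod}(\Lambda)))\le 1$, then $\Lambda$ is an $(n,0,\mathcal{X})$-LIT-algebra and $\mathrm{fin.dim}(\Lambda)\le n+1$. (2) Let $\mathrm{Gproj}(\Lambda)$ be the class of Gorenstein projective modules, i.e. of those $M\in\mathrm{mod}(\Lambda)$ that are isomorphic to the kernel of a differential in an acyclic complex $P_\bullet$ (indexed by $\mathbb{Z}$) of finitely generated projective modules such that $\mathrm{Hom}_\Lambda(P_\bullet,Q)$ is acyclic for each finitely generated projective $Q$. If $\mathrm{resdim}_{\mathrm{Gproj}(\Lambda)}(\Omega^n(\mathrm{mod}(\Lambda)))\le 1$, then $\Lambda$ is an $(n,0,\mathrm{Gproj}(\Lambda))$-LIT-algebra and $\mathrm{fin.dim}(\Lambda)\le n+1$. -/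

import Mathlib

open Function

universe u

noncomputable section

namespace ArtinAlg

/-- `Λ` is an Artin algebra: a ring that is finitely generated as a module over a commutative
Artinian ring acting centrally on it. -/
class IsArtinAlgebra (Λ : Type u) [Ring Λ] : Prop where
  exists_base : ∃ (R : Type u) (_ : CommRing R) (_ : IsArtinianRing R) (_ : Algebra R Λ),
    Module.Finite R Λ

instance isArtinianRing (Λ : Type u) [Ring Λ] [h : IsArtinAlgebra Λ] : IsArtinianRing Λ := by
  obtain ⟨R, _, _, _, _⟩ := h.exists_base
  exact IsArtinianRing.of_finite R Λ

section ProjectiveCover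

/-- A projective cover: a surjection from a projective module with superfluous kernel. -/
def IsProjectiveCover {Λ : Type u} [Ring Λ] {P M : Type u} [AddCommGroup P] [AddCommGroup M]
    [Module Λ P] [Module Λ M] (f : P →ₗ[Λ] M) : Prop :=
  Module.Projective Λ P ∧ Surjective f ∧
    ∀ N : Submodule Λ P, N ⊔ LinearMap.ker f = ⊤ → N = ⊤

variable {Λ : Type u} [Ring Λ] {P Q M N : Type u} [AddCommGroup P] [AddCommGroup Q]
  [AddCommGroup M] [AddCommGroup N] [Module Λ P] [Module Λ Q] [Module Λ M] [Module Λ N]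

theorem isProjectiveCover_id [Module.Projective Λ P] :
    IsProjectiveCover (LinearMap.id : P →ₗ[Λ] P) := by
  refine ⟨inferInstance, surjective_id, fun N hN => ?_⟩
  simpa using hN

/-- Projective covers of isomorphic modules have isomorphic kernels. -/
theorem IsProjectiveCover.ker_equiv {f : P →ₗ[Λ] M} {g : Q →ₗ[Λ] N} (hf : IsProjectiveCover f)
    (hg : IsProjectiveCover g) (e : M ≃ₗ[Λ] N) :
    Nonempty (LinearMap.ker f ≃ₗ[Λ] LinearMap.ker g) := by
  obtain ⟨hP, hfs, hfk⟩ := hf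
  obtain ⟨hQ, hgs, hgk⟩ := hg
  obtain ⟨h, hh⟩ := Module.projective_lifting_property g (e.toLinearMap ∘ₗ f) hgs
  have hh' : ∀ p, g (h p) = e (f p) := fun p => LinearMap.congr_fun hh p
  have hsurj : Surjective h := by
    rw [← LinearMap.range_eq_top]
    apply hgk
    rw [eq_top_iff]
    intro q _
    obtain ⟨p, hp⟩ := hfs (e.symm (g q))
    have h1 : g (h p) = g q := by rw [hh', hp]; simp
    have h2 : q = h p + (q - h p) := by abel
    rw [h2]
    exact Submodule.add_mem_sup ⟨p, rfl⟩ (by simp [LinearMap.mem_ker, h1])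
  obtain ⟨s, hs⟩ := Module.projective_lifting_property h LinearMap.id hsurj
  have hs' : ∀ q, h (s q) = q := fun q => LinearMap.congr_fun hs q
  have hrange : LinearMap.range s = ⊤ := by
    apply hfk
    rw [eq_top_iff]
    intro p _
    have h2 : p = s (h p) + (p - s (h p)) := by abel
    rw [h2]
    refine Submodule.add_mem_sup ⟨h p, rfl⟩ ?_
    rw [LinearMap.mem_ker]
    apply e.injective
    rw [← hh', map_sub, hs']
    simp
  have hinj : Injective h := by
    intro a b hab
    obtain ⟨a', rfl⟩ := LinearMap.range_eq_top.mp hrange a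
    obtain ⟨b', rfl⟩ := LinearMap.range_eq_top.mp hrange b
    rw [hs', hs'] at hab
    rw [hab]
  let E : P ≃ₗ[Λ] Q := LinearEquiv.ofBijective h ⟨hinj, hsurj⟩
  refine ⟨LinearEquiv.ofSubmodules E _ _ ?_⟩
  ext q
  constructor
  · rintro ⟨p, hp, rfl⟩
    have hp' : f p = 0 := hp
    change g (h p) = 0
    rw [hh', hp', map_zero]
  · intro hq
    obtain ⟨p, rfl⟩ := hsurj q
    refine ⟨p, ?_, rfl⟩
    have hq' : g (h p) = 0 := hq
    rw [hh'] at hq'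
    exact e.map_eq_zero_iff.mp hq'

theorem IsProjectiveCover.prodMap {f : P →ₗ[Λ] M} {g : Q →ₗ[Λ] N} (hf : IsProjectiveCover f)
    (hg : IsProjectiveCover g) : IsProjectiveCover (f.prodMap g) := by
  obtain ⟨hP, hfs, hfk⟩ := hf
  obtain ⟨hQ, hgs, hgk⟩ := hg
  refine ⟨inferInstance, ?_, fun S hS => ?_⟩
  · rintro ⟨m, n⟩
    obtain ⟨p, rfl⟩ := hfs m
    obtain ⟨q, rfl⟩ := hgs n
    exact ⟨(p, q), rfl⟩
  · have key : ∀ x : P × Q, ∃ y ∈ S, f x.1 = f y.1 ∧ g x.2 = g y.2 := by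
      intro x
      have hx : x ∈ S ⊔ LinearMap.ker (f.prodMap g) := by rw [hS]; trivial
      obtain ⟨y, hy, z, hz, rfl⟩ := Submodule.mem_sup.mp hx
      have hz1 : f z.1 = 0 := congrArg Prod.fst (LinearMap.mem_ker.mp hz)
      have hz2 : g z.2 = 0 := congrArg Prod.snd (LinearMap.mem_ker.mp hz)
      exact ⟨y, hy, by simp [hz1], by simp [hz2]⟩
    have hB : (S ⊔ (LinearMap.ker f).map (LinearMap.inl Λ P Q)).comap
        (LinearMap.inr Λ P Q) = ⊤ := by
      apply hgk
      rw [eq_top_iff]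
      intro q _
      obtain ⟨y, hy, hy1, hy2⟩ := key (0, q)
      have h2 : q = y.2 + (q - y.2) := by abel
      rw [h2]
      refine Submodule.add_mem_sup ?_ (by simpa [LinearMap.mem_ker, sub_eq_zero] using hy2)
      have h3 : (LinearMap.inr Λ P Q) y.2 = y + (LinearMap.inl Λ P Q) (-y.1) := by
        ext <;> simp
      rw [Submodule.mem_comap, h3]
      refine Submodule.add_mem_sup hy ⟨-y.1, ?_, rfl⟩
      simp only [map_zero] at hy1
      simp [← hy1]
    have hA : (S ⊔ (LinearMap.ker f).map (LinearMap.inl Λ P Q)) = ⊤ := by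
      rw [eq_top_iff]
      rintro x -
      obtain ⟨y, hy, hy1, hy2⟩ := key x
      have hx2 : x.2 - y.2 ∈ (S ⊔ (LinearMap.ker f).map (LinearMap.inl Λ P Q)).comap
          (LinearMap.inr Λ P Q) := by rw [hB]; trivial
      have h3 : x = y + (LinearMap.inl Λ P Q) (x.1 - y.1) +
          (LinearMap.inr Λ P Q) (x.2 - y.2) := by
        ext <;> simp
      rw [h3]
      refine add_mem (Submodule.add_mem_sup hy ⟨_, ?_, rfl⟩) hx2
      simp [hy1]
    have hC : S.comap (LinearMap.inl Λ P Q) = ⊤ := by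
      apply hfk
      rw [eq_top_iff]
      intro p _
      have hp : (LinearMap.inl Λ P Q) p ∈ S ⊔ (LinearMap.ker f).map (LinearMap.inl Λ P Q) := by
        rw [hA]; trivial
      obtain ⟨y, hy, z, ⟨k, hk, rfl⟩, hyz⟩ := Submodule.mem_sup.mp hp
      have h4 : p = (p - k) + k := by abel
      rw [h4]
      refine Submodule.add_mem_sup ?_ hk
      rw [Submodule.mem_comap, map_sub, ← hyz]
      simpa using hy
    rw [eq_top_iff]
    rintro x -
    have hx : x ∈ S ⊔ (LinearMap.ker f).map (LinearMap.inl Λ P Q) := by rw [hA]; trivial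
    obtain ⟨y, hy, z, ⟨k, hk, rfl⟩, rfl⟩ := Submodule.mem_sup.mp hx
    have hk' : k ∈ S.comap (LinearMap.inl Λ P Q) := by rw [hC]; trivial
    exact add_mem hy hk'

/-- Over a left Artinian ring every finitely generated module has a projective cover. -/
theorem exists_isProjectiveCover [IsArtinianRing Λ] (M : FGModuleCat.{u} Λ) :
    ∃ (P : FGModuleCat.{u} Λ) (f : P →ₗ[Λ] M), IsProjectiveCover f := by
  classical
  let T : Set ℕ := {l | ∃ (P : FGModuleCat.{u} Λ) (f : P →ₗ[Λ] M), Module.Projective Λ P ∧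
    Surjective f ∧ Module.length Λ P = l}
  have hlen : ∀ P : FGModuleCat.{u} Λ, Module.length Λ P ≠ ⊤ := fun P =>
    Module.length_ne_top_iff.mpr (isFiniteLength_iff_isNoetherian_isArtinian.mpr
      ⟨inferInstance, inferInstance⟩)
  have hT : T.Nonempty := by
    obtain ⟨k, f, hf⟩ := Module.Finite.exists_fin' Λ M
    obtain ⟨l, hl⟩ := ENat.ne_top_iff_exists.mp (hlen (FGModuleCat.of Λ (Fin k → Λ)))
    exact ⟨l, FGModuleCat.of Λ (Fin k → Λ), f,
      inferInstanceAs (Module.Projective Λ (Fin k → Λ)), hf, hl.symm⟩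
  obtain ⟨P, f, hP, hf, hPl⟩ := Nat.sInf_mem hT
  refine ⟨P, f, hP, hf, fun N hN => ?_⟩
  have hfN : Surjective (f ∘ₗ N.subtype) := by
    intro m
    obtain ⟨p, rfl⟩ := hf m
    have hp : p ∈ N ⊔ LinearMap.ker f := by rw [hN]; trivial
    obtain ⟨a, ha, b, hb, rfl⟩ := Submodule.mem_sup.mp hp
    exact ⟨⟨a, ha⟩, by simp [LinearMap.mem_ker.mp hb]⟩
  obtain ⟨g, hg⟩ := Module.projective_lifting_property (f ∘ₗ N.subtype) f hfN
  let h : Module.End Λ P := N.subtype ∘ₗ g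
  have hfh : ∀ p, f (h p) = f p := fun p => LinearMap.congr_fun hg p
  have hfhn : ∀ (k : ℕ) p, f ((h ^ k) p) = f p := by
    intro k
    induction k with
    | zero => intro p; rfl
    | succ k ih => intro p; rw [pow_succ', Module.End.mul_apply, hfh, ih]
  obtain ⟨k, hk⟩ := Filter.eventually_atTop.mp
    (LinearMap.eventually_isCompl_ker_pow_range_pow h)
  have hc := hk (k + 1) (by omega)
  have hproj : Module.Projective Λ (LinearMap.range (h ^ (k + 1))) := by
    refine Module.Projective.of_split (LinearMap.range (h ^ (k + 1))).subtype
      (Submodule.projectionOnto _ _ hc.symm) ?_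
    ext x
    simp
  have hsur : Surjective (f ∘ₗ (LinearMap.range (h ^ (k + 1))).subtype) := by
    intro m
    obtain ⟨p, rfl⟩ := hf m
    exact ⟨⟨(h ^ (k + 1)) p, p, rfl⟩, hfhn (k + 1) p⟩
  have hrange : LinearMap.range (h ^ (k + 1)) = ⊤ := by
    obtain ⟨l, hl⟩ := ENat.ne_top_iff_exists.mp
      (hlen (FGModuleCat.of Λ (LinearMap.range (h ^ (k + 1)))))
    have hlT : l ∈ T := ⟨FGModuleCat.of Λ (LinearMap.range (h ^ (k + 1))), _, hproj, hsur, hl.symm⟩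
    have hle := Nat.sInf_le hlT
    by_contra hne
    have hlt : Module.length Λ (LinearMap.range (h ^ (k + 1))) < Module.length Λ P :=
      Submodule.length_lt hne
    rw [hPl] at hlt
    change (l : ℕ∞) = Module.length Λ (LinearMap.range (h ^ (k + 1))) at hl
    rw [← hl] at hlt
    exact absurd (by exact_mod_cast hlt) (not_lt.mpr hle)
  rw [eq_top_iff, ← hrange]
  rintro _ ⟨p, rfl⟩
  rw [pow_succ', Module.End.mul_apply]
  exact (g ((h ^ k) p)).2

end ProjectiveCover

variable (Λ : Type u) [Ring Λ]

section Classes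

variable {Λ}

/-- `add 𝒟`: the direct summands of finite direct sums of modules in `𝒟`. -/
def addClosure (𝒟 : Set (FGModuleCat.{u} Λ)) : Set (FGModuleCat.{u} Λ) :=
  {M | ∃ (k : ℕ) (D : Fin k → FGModuleCat.{u} Λ) (N : FGModuleCat.{u} Λ),
    (∀ i, D i ∈ 𝒟) ∧ Nonempty ((M × N) ≃ₗ[Λ] (∀ i, D i))}

/-- Left saturated classes: closed under extensions, kernels of epimorphisms and direct
summands, and containing the projectives. -/
structure IsLeftSaturated (𝒳 : Set (FGModuleCat.{u} Λ)) : Prop where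
  extension : ∀ (A B C : FGModuleCat.{u} Λ) (f : A →ₗ[Λ] B) (g : B →ₗ[Λ] C),
    Injective f → Exact f g → Surjective g → A ∈ 𝒳 → C ∈ 𝒳 → B ∈ 𝒳
  kernel : ∀ (A B C : FGModuleCat.{u} Λ) (f : A →ₗ[Λ] B) (g : B →ₗ[Λ] C),
    Injective f → Exact f g → Surjective g → B ∈ 𝒳 → C ∈ 𝒳 → A ∈ 𝒳
  projective : ∀ P : FGModuleCat.{u} Λ, Module.Projective Λ P → P ∈ 𝒳
  summand : ∀ M N X : FGModuleCat.{u} Λ, Nonempty ((M × N) ≃ₗ[Λ] X) → X ∈ 𝒳 → M ∈ 𝒳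

/-- There is an exact sequence `0 → X n → ⋯ → X 1 → X 0 → M → 0` with all `X i` in `𝒳`. -/
def HasResolution (𝒳 : Set (FGModuleCat.{u} Λ)) (n : ℕ) (M : FGModuleCat.{u} Λ) : Prop :=
  ∃ (X : ℕ → FGModuleCat.{u} Λ) (d : ∀ i, X (i + 1) →ₗ[Λ] X i) (ε : X 0 →ₗ[Λ] M),
    (∀ i ≤ n, X i ∈ 𝒳) ∧ (∀ i > n, Subsingleton (X i)) ∧
    (∀ i, Exact (d (i + 1)) (d i)) ∧ Exact (d 0) ε ∧ Surjective ε

/-- The `𝒳`-resolution dimension of a module. -/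
def resdim (𝒳 : Set (FGModuleCat.{u} Λ)) (M : FGModuleCat.{u} Λ) : ℕ∞ :=
  ⨅ (n : ℕ) (_ : HasResolution 𝒳 n M), (n : ℕ∞)

/-- The `𝒳`-resolution dimension of a class of modules. -/
def resdimClass (𝒳 𝒴 : Set (FGModuleCat.{u} Λ)) : ℕ∞ :=
  ⨆ Y ∈ 𝒴, resdim 𝒳 Y

variable (Λ)

/-- The Gorenstein projective modules: `M` is isomorphic to a cycle module of an acyclic complex
of finitely generated projective modules which stays acyclic under `Hom(-, Q)` for every finitely
generated projective `Q`. -/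
def Gproj : Set (FGModuleCat.{u} Λ) :=
  {M | ∃ (P : ℤ → FGModuleCat.{u} Λ) (d : ∀ m : ℤ, P (m + 1) →ₗ[Λ] P m),
    (∀ m, Module.Projective Λ (P m)) ∧
    (∀ m, Exact (d (m + 1)) (d m)) ∧
    (∀ Q : FGModuleCat.{u} Λ, Module.Projective Λ Q → ∀ m : ℤ,
      Exact (fun φ : P m →ₗ[Λ] Q => φ ∘ₗ d m)
        (fun φ : P (m + 1) →ₗ[Λ] Q => φ ∘ₗ d (m + 1))) ∧
    Nonempty (M ≃ₗ[Λ] LinearMap.ker (d 0))}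

/-- The finitistic dimension of `Λ`. -/
def finDim : WithBot ℕ∞ :=
  ⨆ (M : FGModuleCat.{u} Λ)
    (_ : CategoryTheory.projectiveDimension (M.obj : ModuleCat.{u} Λ) ≠ ⊤),
    CategoryTheory.projectiveDimension (M.obj : ModuleCat.{u} Λ)

end Classes

section Syzygy

variable {Λ}
variable [IsArtinianRing Λ]

/-- The syzygy `Ω M`: the kernel of a projective cover of `M`. -/
def syzygy (M : FGModuleCat.{u} Λ) : FGModuleCat.{u} Λ :=
  FGModuleCat.of Λ (LinearMap.ker (exists_isProjectiveCover M).choose_spec.choose)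

theorem syzygy_equiv_ker {M : FGModuleCat.{u} Λ} {P N : Type u} [AddCommGroup P] [AddCommGroup N]
    [Module Λ P] [Module Λ N] {f : P →ₗ[Λ] N} (hf : IsProjectiveCover f) (e : M ≃ₗ[Λ] N) :
    Nonempty (syzygy M ≃ₗ[Λ] LinearMap.ker f) :=
  (exists_isProjectiveCover M).choose_spec.choose_spec.ker_equiv hf e

theorem syzygy_prod {M X Y : FGModuleCat.{u} Λ} (e : M ≃ₗ[Λ] (X × Y)) :
    Nonempty (syzygy M ≃ₗ[Λ] (syzygy X × syzygy Y)) := by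
  obtain ⟨e'⟩ := syzygy_equiv_ker ((exists_isProjectiveCover X).choose_spec.choose_spec.prodMap
    (exists_isProjectiveCover Y).choose_spec.choose_spec) e
  exact ⟨e'.trans
    { toFun := fun x => (⟨x.1.1, congrArg Prod.fst (LinearMap.mem_ker.mp x.2)⟩,
        ⟨x.1.2, congrArg Prod.snd (LinearMap.mem_ker.mp x.2)⟩)
      invFun := fun y => ⟨(y.1.1, y.2.1), Prod.ext y.1.2 y.2.2⟩
      map_add' := fun _ _ => rfl
      map_smul' := fun _ _ => rfl
      left_inv := fun _ => rfl
      right_inv := fun _ => rfl }⟩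

theorem subsingleton_syzygy {P : FGModuleCat.{u} Λ} (hP : Module.Projective Λ P) :
    Subsingleton (syzygy P) := by
  obtain ⟨e⟩ := syzygy_equiv_ker (isProjectiveCover_id (Λ := Λ) (P := P)) (.refl Λ P)
  have : Subsingleton (LinearMap.ker (LinearMap.id : P →ₗ[Λ] P)) := by
    rw [LinearMap.ker_id]; infer_instance
  exact e.injective.subsingleton

end Syzygy

section IgusaTodorov

/-- The relations `[M] = [X] + [Y]` for `M ≅ X ⊕ Y` (in particular `[M] = [X]` for `M ≅ X`) and
`[P] = 0` for `P` projective. -/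
def stableRelations : Set (FreeAbelianGroup (FGModuleCat.{u} Λ)) :=
  {x | ∃ M X Y : FGModuleCat.{u} Λ, Nonempty (M ≃ₗ[Λ] (X × Y)) ∧
    x = FreeAbelianGroup.of M - FreeAbelianGroup.of X - FreeAbelianGroup.of Y} ∪
  {x | ∃ P : FGModuleCat.{u} Λ, Module.Projective Λ P ∧ x = FreeAbelianGroup.of P}

/-- The Igusa–Todorov group: the abelian group generated by the isomorphism classes of finitely
generated modules, modulo direct sums and projectives. -/
abbrev StableGroup : Type (u + 1) :=
  FreeAbelianGroup (FGModuleCat.{u} Λ) ⧸ AddSubgroup.closure (stableRelations Λ)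

variable {Λ}

/-- The class `[M]` in the Igusa–Todorov group. -/
def stableClass (M : FGModuleCat.{u} Λ) : StableGroup Λ :=
  QuotientAddGroup.mk (FreeAbelianGroup.of M)

theorem stableClass_prod {M X Y : FGModuleCat.{u} Λ} (e : M ≃ₗ[Λ] (X × Y)) :
    stableClass M = stableClass X + stableClass Y := by
  have h : FreeAbelianGroup.of M - FreeAbelianGroup.of X - FreeAbelianGroup.of Y ∈
      AddSubgroup.closure (stableRelations Λ) :=
    AddSubgroup.subset_closure (Or.inl ⟨M, X, Y, ⟨e⟩, rfl⟩)
  have h' := (QuotientAddGroup.eq_zero_iff _).mpr h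
  rw [QuotientAddGroup.mk_sub, QuotientAddGroup.mk_sub, sub_sub, sub_eq_zero] at h'
  exact h'

theorem stableClass_projective {P : FGModuleCat.{u} Λ} (hP : Module.Projective Λ P) :
    stableClass P = 0 :=
  (QuotientAddGroup.eq_zero_iff _).mpr (AddSubgroup.subset_closure (Or.inr ⟨P, hP, rfl⟩))

/-- The endomorphism `L` of the Igusa–Todorov group with `L [M] = [Ω M]`. -/
def stableSyzygy [IsArtinianRing Λ] : StableGroup Λ →+ StableGroup Λ :=
  QuotientAddGroup.lift (AddSubgroup.closure (stableRelations Λ))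
    (FreeAbelianGroup.lift fun M => stableClass (syzygy M)) <| by
      rw [AddSubgroup.closure_le]
      rintro x (⟨M, X, Y, ⟨e⟩, rfl⟩ | ⟨P, hP, rfl⟩)
      · obtain ⟨e'⟩ := syzygy_prod e
        simp [AddMonoidHom.mem_ker, stableClass_prod e']
      · have := subsingleton_syzygy hP
        simpa [AddMonoidHom.mem_ker] using stableClass_projective (P := syzygy P) inferInstance

theorem stableSyzygy_stableClass [IsArtinianRing Λ] (M : FGModuleCat.{u} Λ) :
    stableSyzygy (stableClass M) = stableClass (syzygy M) := by
  exact FreeAbelianGroup.lift_apply_of _ _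

/-- The subgroup `⟨X⟩` generated by the classes of the modules in `add X`. -/
def stableSpan (X : FGModuleCat.{u} Λ) : AddSubgroup (StableGroup Λ) :=
  AddSubgroup.closure (stableClass '' addClosure {X})

/-- The least `k` such that `f` restricts to an isomorphism from `f ^ m (H)` onto `f ^ (m + 1) (H)` for all
`m ≥ k` (`⊤` if there is none). -/
def fittingIndex {A : Type*} [AddCommGroup A] (f : A →+ A) (H : AddSubgroup A) : ℕ∞ :=
  ⨅ (k : ℕ) (_ : ∀ m ≥ k, Set.BijOn f (f^[m] '' (H : Set A)) (f^[m + 1] '' (H : Set A))), (k : ℕ∞)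

/-- The Igusa–Todorov function `Φ`. -/
def igusaTodorovPhi [IsArtinianRing Λ] (X : FGModuleCat.{u} Λ) : ℕ∞ :=
  fittingIndex stableSyzygy (stableSpan X)

/-- The `Φ`-dimension of a class of modules. -/
def phiDim [IsArtinianRing Λ] (𝒳 : Set (FGModuleCat.{u} Λ)) : ℕ∞ :=
  ⨆ X ∈ 𝒳, igusaTodorovPhi X

/-- `Λ` is an `(n, V, 𝒟)`-Lat-Igusa-Todorov algebra. -/
structure IsLITAlgebra (Λ : Type u) [Ring Λ] [IsArtinAlgebra Λ] (n : ℕ) (V : FGModuleCat.{u} Λ)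
    (𝒟 : Set (FGModuleCat.{u} Λ)) : Prop where
  add_eq : addClosure 𝒟 = 𝒟
  syzygy_subset : syzygy '' 𝒟 ⊆ 𝒟
  phiDim_eq_zero : phiDim 𝒟 = 0
  exists_exact : ∀ M : FGModuleCat.{u} Λ, ∃ V₁ ∈ addClosure {V}, ∃ V₀ ∈ addClosure {V},
    ∃ D₁ ∈ 𝒟, ∃ D₀ ∈ 𝒟, ∃ (f : (V₁ × D₁) →ₗ[Λ] (V₀ × D₀))
      (g : (V₀ × D₀) →ₗ[Λ] (syzygy^[n] M : FGModuleCat.{u} Λ)),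
      Injective f ∧ Exact f g ∧ Surjective g

end IgusaTodorov

end ArtinAlg

end

open ArtinAlg

/-! Part (1). Put N = Ωⁿ M with M of finite projective dimension. A resolution 0 → X₁ → X₀ → N → 0
in 𝒳 can be traded for 0 → K → P → N → 0 with P projective and K still in 𝒳, because K is an
extension of X₁ by Ω X₀ (`IsLeftSaturated.exists_isShortExact_projective`). Now K has finite
projective dimension, so some power of L kills [K]. Since Φ vanishes on 𝒳, L is injective along the
orbit of ⟨K⟩, so [K] = 0. The length of Ω K is an additive invariant that vanishes on projectives,
so [K] = 0 forces K to be projective (`stableClass_eq_zero_iff`). Hence pd N ≤ 1 and pd M ≤ n + 1.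
The LIT property is the given resolution with V = 0.

Part (2) applies part (1) to Gorenstein projectives, which requires two facts. They are left
saturated: Gproj is the largest class whose members are Ext-orthogonal to projectives and embed in
projectives with cokernel in the class (`IsCosyzygyClass.subset_Gproj`). So each closure property is
proved coinductively, by exhibiting one cosyzygy step. And Φ vanishes on them: the cokernel of a
left projective approximation induces an additive endomorphism of the Igusa–Todorov group that
undoes L on Gorenstein projectives (`stableCosyzygy_stableSyzygy`). -/

noncomputable section

namespace ArtinAlg

open CategoryTheory Abelian

/-! ### Short exact sequences and vanishing of Ext. -/

section ShortExact

variable {Λ : Type u} [Ring Λ] {A B C M N X Q : Type u}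
  [AddCommGroup A] [AddCommGroup B] [AddCommGroup C] [AddCommGroup M] [AddCommGroup N]
  [AddCommGroup X] [AddCommGroup Q]
  [Module Λ A] [Module Λ B] [Module Λ C] [Module Λ M] [Module Λ N] [Module Λ X] [Module Λ Q]

/-- The sequence `0 → A → B → C → 0` is exact. -/
structure IsShortExact (f : A →ₗ[Λ] B) (g : B →ₗ[Λ] C) : Prop where
  injective : Injective f
  exact : Exact f g
  surjective : Surjective g

theorem IsShortExact.shortExact {f : A →ₗ[Λ] B} {g : B →ₗ[Λ] C} (h : IsShortExact f g) :
    (ShortComplex.mk (ModuleCat.ofHom f) (ModuleCat.ofHom g)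
      (by ext x; exact h.exact.apply_apply_eq_zero x)).ShortExact :=
  ModuleCat.shortComplex_shortExact _ h.exact h.injective h.surjective

variable (Λ) in
/-- The vanishing of `Ext^i(M, Q)`. -/
def ExtVanishes (M Q : Type u) [AddCommGroup M] [AddCommGroup Q] [Module Λ M] [Module Λ Q]
    (i : ℕ) : Prop :=
  Subsingleton (Ext (ModuleCat.of Λ M) (ModuleCat.of Λ Q) i)

theorem ExtVanishes.middle {f : A →ₗ[Λ] B} {g : B →ₗ[Λ] C} (h : IsShortExact f g) {i : ℕ}
    (hA : ExtVanishes Λ A Q i) (hC : ExtVanishes Λ C Q i) : ExtVanishes Λ B Q i := by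
  refine subsingleton_of_forall_eq 0 fun x => ?_
  obtain ⟨y, rfl⟩ := Ext.contravariant_sequence_exact₂ h.shortExact _ x (hA.elim _ _)
  rw [hC.elim y 0, Ext.comp_zero]

theorem ExtVanishes.left {f : A →ₗ[Λ] B} {g : B →ₗ[Λ] C} (h : IsShortExact f g) {i : ℕ}
    (hB : ExtVanishes Λ B Q i) (hC : ExtVanishes Λ C Q (i + 1)) : ExtVanishes Λ A Q i := by
  refine subsingleton_of_forall_eq 0 fun x => ?_
  obtain ⟨y, rfl⟩ := Ext.contravariant_sequence_exact₁ h.shortExact _ x (add_comm 1 i)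
    (hC.elim _ _)
  rw [hB.elim y 0, Ext.comp_zero]

theorem ExtVanishes.right {f : A →ₗ[Λ] B} {g : B →ₗ[Λ] C} (h : IsShortExact f g) {i : ℕ}
    (hA : ExtVanishes Λ A Q i) (hB : ExtVanishes Λ B Q (i + 1)) : ExtVanishes Λ C Q (i + 1) := by
  refine subsingleton_of_forall_eq 0 fun x => ?_
  obtain ⟨y, rfl⟩ := Ext.contravariant_sequence_exact₃ h.shortExact _ x (hB.elim _ _)
    (add_comm 1 i)
  rw [hA.elim y 0, Ext.comp_zero]

theorem ExtVanishes.of_retract {s : M →ₗ[Λ] X} {r : X →ₗ[Λ] M} (h : r ∘ₗ s = LinearMap.id) {i : ℕ}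
    (hX : ExtVanishes Λ X Q i) : ExtVanishes Λ M Q i := by
  refine subsingleton_of_forall_eq 0 fun x => ?_
  have h' : ModuleCat.ofHom s ≫ ModuleCat.ofHom r = 𝟙 (ModuleCat.of Λ M) := by
    rw [← ModuleCat.ofHom_comp, h]; rfl
  rw [← x.mk₀_id_comp, ← h', ← Ext.mk₀_comp_mk₀, Ext.comp_assoc_of_second_deg_zero,
    hX.elim ((Ext.mk₀ (ModuleCat.ofHom r)).comp x (zero_add i)) 0, Ext.comp_zero]

theorem extVanishes_of_projective [Module.Projective Λ M] (i : ℕ) :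
    ExtVanishes Λ M Q (i + 1) := by
  have : Projective (ModuleCat.of Λ M) := (IsProjective.iff_projective M).mp inferInstance
  exact subsingleton_of_forall_eq 0 fun x => x.eq_zero_of_projective

theorem ExtVanishes.exists_extension {f : A →ₗ[Λ] B} {g : B →ₗ[Λ] C} (h : IsShortExact f g)
    (hC : ExtVanishes Λ C Q 1) (φ : A →ₗ[Λ] Q) : ∃ ψ : B →ₗ[Λ] Q, ψ ∘ₗ f = φ := by
  obtain ⟨y, hy⟩ := Ext.contravariant_sequence_exact₁ h.shortExact _
    (Ext.mk₀ (ModuleCat.ofHom φ)) (add_zero 1) (hC.elim _ _)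
  obtain ⟨ψ, rfl⟩ := Ext.homEquiv₀.symm.surjective y
  refine ⟨ψ.hom, ?_⟩
  have h1 : ModuleCat.ofHom f ≫ ψ = ModuleCat.ofHom φ :=
    Ext.homEquiv₀.symm.injective (by simpa using hy)
  exact congrArg ModuleCat.Hom.hom h1

/-- As Ext¹(B, Q) = 0, every class in Ext¹(C, Q) comes from some φ : A → Q under the connecting map,
and a φ that extends to B is sent to zero. -/
theorem extVanishes_one_of_exists_extension {f : A →ₗ[Λ] B} {g : B →ₗ[Λ] C}
    (h : IsShortExact f g) [Module.Projective Λ B]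
    (hext : ∀ φ : A →ₗ[Λ] Q, ∃ ψ : B →ₗ[Λ] Q, ψ ∘ₗ f = φ) : ExtVanishes Λ C Q 1 := by
  refine subsingleton_of_forall_eq 0 fun x => ?_
  obtain ⟨y, rfl⟩ := Ext.contravariant_sequence_exact₃ h.shortExact _ x
    ((extVanishes_of_projective (Λ := Λ) (M := B) 0).elim _ _) (add_zero 1)
  obtain ⟨φ, rfl⟩ := Ext.homEquiv₀.symm.surjective y
  obtain ⟨ψ, hψ⟩ := hext φ.hom
  have h1 : Ext.homEquiv₀.symm φ =
      (Ext.mk₀ (ModuleCat.ofHom f)).comp (Ext.mk₀ (ModuleCat.ofHom ψ)) (zero_add 0) := by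
    exact (congrArg Ext.mk₀ (ModuleCat.hom_ext hψ.symm)).trans (Ext.mk₀_comp_mk₀ _ _).symm
  rw [h1]
  exact h.shortExact.extClass_comp_assoc _

theorem isShortExact_ker {f : B →ₗ[Λ] C} (hf : Surjective f) :
    IsShortExact (LinearMap.ker f).subtype f :=
  ⟨Subtype.val_injective, f.exact_subtype_ker_map, hf⟩

theorem IsShortExact.comp_equiv {f : A →ₗ[Λ] B} {g : B →ₗ[Λ] C} (h : IsShortExact f g)
    (e : M ≃ₗ[Λ] A) : IsShortExact (f ∘ₗ e.toLinearMap) g := by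
  refine ⟨h.injective.comp e.injective, fun b => ?_, h.surjective⟩
  rw [h.exact b]
  constructor
  · rintro ⟨a, rfl⟩
    exact ⟨e.symm a, by simp⟩
  · rintro ⟨m, rfl⟩
    exact ⟨e m, rfl⟩

theorem isShortExact_inl_snd : IsShortExact (LinearMap.inl Λ A B) (LinearMap.snd Λ A B) :=
  ⟨LinearMap.inl_injective, Function.Exact.inl_snd, LinearMap.snd_surjective⟩

/-- Surjections with the same kernel have isomorphic targets. -/
theorem nonempty_equiv_of_ker_eq {f : A →ₗ[Λ] B} {g : A →ₗ[Λ] C} (hf : Surjective f)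
    (hg : Surjective g) (h : LinearMap.ker f = LinearMap.ker g) : Nonempty (B ≃ₗ[Λ] C) :=
  ⟨(f.quotKerEquivOfSurjective hf).symm ≪≫ₗ Submodule.quotEquivOfEq _ _ h ≪≫ₗ
    g.quotKerEquivOfSurjective hg⟩

theorem exists_factor_of_ker_le {f : A →ₗ[Λ] B} (hf : Surjective f) {g : A →ₗ[Λ] C}
    (h : LinearMap.ker f ≤ LinearMap.ker g) : ∃ k : B →ₗ[Λ] C, ∀ x, k (f x) = g x := by
  refine ⟨(LinearMap.ker f).liftQ g h ∘ₗ (f.quotKerEquivOfSurjective hf).symm.toLinearMap,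
    fun x => ?_⟩
  have hx : (f.quotKerEquivOfSurjective hf).symm (f x) = Submodule.Quotient.mk x := by
    rw [LinearEquiv.symm_apply_eq]
    rfl
  rw [LinearMap.comp_apply, LinearEquiv.coe_coe, hx]
  rfl

theorem exists_factor_of_range_le {f : B →ₗ[Λ] C} (hf : Injective f) {g : A →ₗ[Λ] C}
    (h : ∀ x, g x ∈ LinearMap.range f) : ∃ k : A →ₗ[Λ] B, ∀ x, f (k x) = g x :=
  ⟨(LinearEquiv.ofInjective f hf).symm.toLinearMap ∘ₗ g.codRestrict _ h, fun x =>
    congrArg Subtype.val ((LinearEquiv.ofInjective f hf).apply_symm_apply ⟨g x, h x⟩)⟩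

end ShortExact

/-! ### Left saturated classes and short resolutions. -/

section LeftSaturated

variable {Λ : Type u} [Ring Λ]

theorem IsLeftSaturated.of_equiv {𝒳 : Set (FGModuleCat.{u} Λ)} (h : IsLeftSaturated 𝒳)
    {M N : FGModuleCat.{u} Λ} (e : M ≃ₗ[Λ] N) (hN : N ∈ 𝒳) : M ∈ 𝒳 :=
  h.summand M (FGModuleCat.of Λ PUnit.{u + 1}) N ⟨LinearEquiv.prodUnique ≪≫ₗ e⟩ hN

theorem IsLeftSaturated.pi {𝒳 : Set (FGModuleCat.{u} Λ)} (h : IsLeftSaturated 𝒳) {k : ℕ}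
    (D : Fin k → FGModuleCat.{u} Λ) (hD : ∀ i, D i ∈ 𝒳) :
    FGModuleCat.of Λ (∀ i, D i) ∈ 𝒳 := by
  induction k with
  | zero =>
    exact h.projective _ (inferInstanceAs (Module.Projective Λ (∀ i : Fin 0, D i)))
  | succ k ih =>
    refine h.of_equiv (N := FGModuleCat.of Λ (D 0 × ∀ i : Fin k, D i.succ))
      (Fin.consLinearEquiv Λ fun i => D i).symm ?_
    have hs := isShortExact_inl_snd (Λ := Λ) (A := D 0) (B := ∀ i : Fin k, D i.succ)
    exact h.extension (D 0) _ (FGModuleCat.of Λ (∀ i : Fin k, D i.succ)) _ _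
      hs.injective hs.exact hs.surjective (hD 0) (ih _ fun i => hD i.succ)

theorem subset_addClosure (𝒟 : Set (FGModuleCat.{u} Λ)) : 𝒟 ⊆ addClosure 𝒟 := fun M hM =>
  ⟨1, fun _ => M, FGModuleCat.of Λ PUnit.{u + 1}, fun _ => hM,
    ⟨LinearEquiv.prodUnique ≪≫ₗ (LinearEquiv.funUnique (Fin 1) Λ M).symm⟩⟩

theorem addClosure_mono {𝒟 ℰ : Set (FGModuleCat.{u} Λ)} (h : 𝒟 ⊆ ℰ) :
    addClosure 𝒟 ⊆ addClosure ℰ :=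
  fun _ ⟨k, D, N, hD, e⟩ => ⟨k, D, N, fun i => h (hD i), e⟩

theorem IsLeftSaturated.addClosure_eq {𝒳 : Set (FGModuleCat.{u} Λ)} (h : IsLeftSaturated 𝒳) :
    addClosure 𝒳 = 𝒳 := by
  refine Set.Subset.antisymm ?_ (subset_addClosure 𝒳)
  rintro M ⟨k, D, N, hD, e⟩
  exact h.summand M N (FGModuleCat.of Λ (∀ i, D i)) e (h.pi D hD)

theorem exists_hasResolution_of_resdim_le {𝒳 : Set (FGModuleCat.{u} Λ)} {M : FGModuleCat.{u} Λ}
    {k : ℕ} (h : resdim 𝒳 M ≤ k) : ∃ n ≤ k, HasResolution 𝒳 n M := by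
  by_contra! hne
  have h1 : ((k + 1 : ℕ) : ℕ∞) ≤ resdim 𝒳 M := by
    refine le_iInf₂ fun n hn => ?_
    by_contra! hlt
    exact hne n (Nat.lt_succ_iff.mp (by exact_mod_cast hlt)) hn
  have h2 := h1.trans h
  norm_cast at h2
  omega

theorem exists_isShortExact_of_resdim_le_one {𝒳 : Set (FGModuleCat.{u} Λ)}
    (h : IsLeftSaturated 𝒳) {M : FGModuleCat.{u} Λ} (hM : resdim 𝒳 M ≤ 1) :
    ∃ X₁ ∈ 𝒳, ∃ X₀ ∈ 𝒳, ∃ (f : X₁ →ₗ[Λ] X₀) (g : X₀ →ₗ[Λ] M), IsShortExact f g := by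
  obtain ⟨n, hn, X, d, ε, hX, hX', hd, hε, hs⟩ :=
    exists_hasResolution_of_resdim_le (k := 1) (by exact_mod_cast hM)
  have hinj : Injective (d 0) := by
    rw [injective_iff_map_eq_zero]
    intro x hx
    obtain ⟨y, rfl⟩ := (hd 0 x).mp hx
    have := hX' (0 + 1 + 1) (by omega)
    rw [Subsingleton.elim y 0, map_zero]
  refine ⟨X 1, ?_, X 0, hX 0 (Nat.zero_le _), d 0, ε, hinj, hε, hs⟩
  -- For a resolution of length 0 the term `X 1` is zero, which is projective and hence in the
  -- class.
  rcases Nat.lt_or_ge n 1 with h1 | h1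
  · have := hX' 1 h1
    exact h.projective _ inferInstance
  · exact hX 1 h1

theorem hasProjectiveDimensionLT_one_iff {M : FGModuleCat.{u} Λ} :
    HasProjectiveDimensionLT M.obj 1 ↔ Module.Projective Λ M := by
  rw [← projective_iff_hasProjectiveDimensionLT_one]
  exact (IsProjective.iff_projective M).symm

end LeftSaturated

/-! ### Syzygies and projective dimension. -/

section Syzygy

variable {Λ : Type u} [Ring Λ] [IsArtinianRing Λ]

theorem exists_isShortExact_syzygy (M : FGModuleCat.{u} Λ) :
    ∃ (P : FGModuleCat.{u} Λ) (i : syzygy M →ₗ[Λ] P) (p : P →ₗ[Λ] M),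
      Module.Projective Λ P ∧ IsShortExact i p := by
  have h := (exists_isProjectiveCover M).choose_spec.choose_spec
  exact ⟨_, _, _, h.1, isShortExact_ker h.2.1⟩

theorem projective_of_subsingleton_syzygy {M : FGModuleCat.{u} Λ} (h : Subsingleton (syzygy M)) :
    Module.Projective Λ M := by
  obtain ⟨P, i, p, hP, hs⟩ := exists_isShortExact_syzygy M
  have hinj : Injective p := by
    rw [injective_iff_map_eq_zero]
    intro x hx
    obtain ⟨y, rfl⟩ := (hs.exact x).mp hx
    rw [Subsingleton.elim y 0, map_zero]
  exact Module.Projective.of_equiv (LinearEquiv.ofBijective p ⟨hinj, hs.surjective⟩)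

theorem hasProjectiveDimensionLT_syzygy_iff {M : FGModuleCat.{u} Λ} {k : ℕ} :
    HasProjectiveDimensionLT M.obj (k + 2) ↔
      HasProjectiveDimensionLT (syzygy M).obj (k + 1) := by
  obtain ⟨P, i, p, hP, hs⟩ := exists_isShortExact_syzygy M
  exact hs.shortExact.hasProjectiveDimensionLT_X₃_iff k ((IsProjective.iff_projective P).mp hP)

/-- In terms of dimensions: pd M ≤ n + k iff pd Ωⁿ M ≤ k. The index stays positive because bound 0
would say that the module is zero. -/
theorem hasProjectiveDimensionLT_iterate_syzygy_iff {M : FGModuleCat.{u} Λ} {k n : ℕ} :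
    HasProjectiveDimensionLT M.obj (n + k + 1) ↔
      HasProjectiveDimensionLT (syzygy^[n] M).obj (k + 1) := by
  induction n generalizing M with
  | zero => rw [Nat.zero_add]; rfl
  | succ n ih =>
    rw [iterate_succ_apply, ← ih, ← hasProjectiveDimensionLT_syzygy_iff]
    congr! 1
    omega

theorem IsLeftSaturated.syzygy_mem {𝒳 : Set (FGModuleCat.{u} Λ)} (h : IsLeftSaturated 𝒳)
    {M : FGModuleCat.{u} Λ} (hM : M ∈ 𝒳) : syzygy M ∈ 𝒳 := by
  obtain ⟨P, i, p, hP, hs⟩ := exists_isShortExact_syzygy M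
  exact h.kernel _ P M i p hs.injective hs.exact hs.surjective (h.projective P hP) hM

/-- If `N` has an `𝒳`-resolution of length one, then there is an exact sequence
`0 → K → P → N → 0` with `P` projective and `K` in `𝒳`. -/
theorem IsLeftSaturated.exists_isShortExact_projective {𝒳 : Set (FGModuleCat.{u} Λ)}
    (h : IsLeftSaturated 𝒳) {X₁ X₀ N : FGModuleCat.{u} Λ} (h₁ : X₁ ∈ 𝒳) (h₀ : X₀ ∈ 𝒳)
    {f : X₁ →ₗ[Λ] X₀} {g : X₀ →ₗ[Λ] N} (hs : IsShortExact f g) :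
    ∃ K ∈ 𝒳, ∃ (P : FGModuleCat.{u} Λ) (i : K →ₗ[Λ] P) (p : P →ₗ[Λ] N),
      Module.Projective Λ P ∧ IsShortExact i p := by
  obtain ⟨P, i, p, hP, hp⟩ := exists_isShortExact_syzygy X₀
  refine ⟨FGModuleCat.of Λ (LinearMap.ker (g ∘ₗ p)), ?_, P, _, g ∘ₗ p, hP,
    isShortExact_ker (hs.surjective.comp hp.surjective)⟩
  -- With p : P → X₀ a projective cover, restricting p to K = ker (g ∘ p) lands in ker g ≅ X₁,
  -- giving 0 → Ω X₀ → K → X₁ → 0.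
  let a : syzygy X₀ →ₗ[Λ] LinearMap.ker (g ∘ₗ p) := i.codRestrict _ fun x => by
    simp [hp.exact.apply_apply_eq_zero]
  obtain ⟨b, hb⟩ := exists_factor_of_range_le hs.injective
    (g := p ∘ₗ (LinearMap.ker (g ∘ₗ p)).subtype) fun x => (hs.exact _).mp x.2
  refine h.extension (syzygy X₀) _ X₁ a b ?_ ?_ ?_ (h.syzygy_mem h₀) h₁
  · intro x y hxy
    exact hp.injective (congrArg Subtype.val hxy)
  · intro x
    rw [← map_eq_zero_iff f hs.injective, hb]
    refine (hp.exact x.1).trans ?_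
    constructor
    · rintro ⟨y, hy⟩
      exact ⟨y, Subtype.ext hy⟩
    · rintro ⟨y, rfl⟩
      exact ⟨y, rfl⟩
  · intro x
    obtain ⟨y, hy⟩ := hp.surjective (f x)
    refine ⟨⟨y, ?_⟩, hs.injective ?_⟩
    · simp [hy, hs.exact.apply_apply_eq_zero]
    · exact (hb _).trans hy

end Syzygy

/-! ### Consequences of vanishing Φ. -/

section Phi

variable {Λ : Type u} [Ring Λ] [IsArtinianRing Λ]

theorem length_ne_top (M : FGModuleCat.{u} Λ) : Module.length Λ M ≠ ⊤ :=
  Module.length_ne_top_iff.mpr (isFiniteLength_iff_isNoetherian_isArtinian.mpr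
    ⟨inferInstance, inferInstance⟩)

/-- The homomorphism sending the class of `M` to the length of `Ω M`. -/
def syzygyLength : StableGroup Λ →+ ℤ :=
  QuotientAddGroup.lift (AddSubgroup.closure (stableRelations Λ))
    (FreeAbelianGroup.lift fun M => ((Module.length Λ (syzygy M)).toNat : ℤ)) <| by
      rw [AddSubgroup.closure_le]
      rintro x (⟨M, X, Y, ⟨e⟩, rfl⟩ | ⟨P, hP, rfl⟩)
      · obtain ⟨e'⟩ := syzygy_prod e
        simp [AddMonoidHom.mem_ker, e'.length_eq, Module.length_prod,
          ENat.toNat_add (length_ne_top _) (length_ne_top _)]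
      · have := subsingleton_syzygy hP
        simp [AddMonoidHom.mem_ker]

theorem syzygyLength_stableClass (M : FGModuleCat.{u} Λ) :
    syzygyLength (stableClass M) = ((Module.length Λ (syzygy M)).toNat : ℤ) := by
  exact FreeAbelianGroup.lift_apply_of _ _

/-- If [M] = 0 then `syzygyLength` gives Ω M length zero, so the projective cover of M is an
isomorphism. -/
theorem stableClass_eq_zero_iff {M : FGModuleCat.{u} Λ} :
    stableClass M = 0 ↔ Module.Projective Λ M := by
  refine ⟨fun h => projective_of_subsingleton_syzygy ?_, stableClass_projective⟩
  have h1 := syzygyLength_stableClass M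
  rw [h, map_zero] at h1
  have h2 : (Module.length Λ (syzygy M)).toNat = 0 := by exact_mod_cast h1.symm
  rw [ENat.toNat_eq_zero] at h2
  exact Module.length_eq_zero_iff.mp (h2.resolve_right (length_ne_top _))

theorem iterate_stableSyzygy_stableClass (M : FGModuleCat.{u} Λ) (k : ℕ) :
    stableSyzygy^[k] (stableClass M) = stableClass (syzygy^[k] M) := by
  induction k generalizing M with
  | zero => rfl
  | succ k ih => rw [iterate_succ_apply, iterate_succ_apply, stableSyzygy_stableClass, ih]

theorem injOn_iterate_of_fittingIndex_eq_zero {A : Type*} [AddCommGroup A] {f : A →+ A}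
    {H : AddSubgroup A} (h : fittingIndex f H = 0) (k : ℕ) : Set.InjOn f^[k] H := by
  have h0 : ∀ m, Set.BijOn f (f^[m] '' (H : Set A)) (f^[m + 1] '' (H : Set A)) := by
    by_contra hne
    -- If k = 0 were not admissible, every admissible k would be at least 1, and so would the
    -- infimum.
    have h1 : (1 : ℕ∞) ≤ fittingIndex f H := by
      refine le_iInf₂ fun m hm => ?_
      rcases Nat.eq_zero_or_pos m with rfl | hpos
      · exact absurd (fun m => hm m (Nat.zero_le m)) hne
      · exact_mod_cast hpos
    simp [h] at h1
  induction k with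
  | zero => exact fun _ _ _ _ h => h
  | succ k ih =>
    intro x hx y hy hxy
    rw [iterate_succ_apply', iterate_succ_apply'] at hxy
    exact ih hx hy ((h0 k).injOn ⟨x, hx, rfl⟩ ⟨y, hy, rfl⟩ hxy)

/-- Surjectivity onto the next image is automatic, so it suffices that f be injective on an f-stable
subgroup containing H and thus all its iterated images. -/
theorem fittingIndex_eq_zero {A : Type*} [AddCommGroup A] {f : A →+ A} {G H : AddSubgroup A}
    (hHG : H ≤ G) (hG : Set.MapsTo f G G) (hf : Set.InjOn f G) : fittingIndex f H = 0 := by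
  refine le_antisymm (iInf₂_le_of_le 0 (fun m _ => ?_) le_rfl) (zero_le)
  have himage : f^[m + 1] '' (H : Set A) = f '' (f^[m] '' (H : Set A)) := by
    rw [iterate_succ', Set.image_comp]
  rw [himage]
  refine Set.InjOn.bijOn_image (hf.mono ?_)
  rintro _ ⟨x, hx, rfl⟩
  exact hG.iterate m (hHG hx)

/-- Here Ωᵏ X is projective, so Lᵏ[X] = 0 = Lᵏ(0); injectivity of Lᵏ on ⟨X⟩ gives [X] = 0. -/
theorem projective_of_phiDim_eq_zero {𝒳 : Set (FGModuleCat.{u} Λ)} (h : phiDim 𝒳 = 0)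
    {X : FGModuleCat.{u} Λ} (hX : X ∈ 𝒳) {k : ℕ} (hk : HasProjectiveDimensionLT X.obj (k + 1)) :
    Module.Projective Λ X := by
  have h0 : igusaTodorovPhi X = 0 :=
    le_antisymm ((le_iSup₂ (f := fun X (_ : X ∈ 𝒳) => igusaTodorovPhi X) X hX).trans h.le)
      (zero_le)
  have hmem : stableClass X ∈ stableSpan X :=
    AddSubgroup.subset_closure ⟨X, subset_addClosure {X} rfl, rfl⟩
  refine stableClass_eq_zero_iff.mp
    (injOn_iterate_of_fittingIndex_eq_zero h0 k hmem (zero_mem _) ?_)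
  rw [iterate_stableSyzygy_stableClass, iterate_map_zero, stableClass_eq_zero_iff,
    ← hasProjectiveDimensionLT_one_iff]
  exact hasProjectiveDimensionLT_iterate_syzygy_iff (k := 0) (n := k).mp hk

end Phi

/-! ### The LIT property and the bound on the finitistic dimension. -/

section LIT

variable {Λ : Type u} [Ring Λ] [IsArtinAlgebra Λ]

theorem IsLeftSaturated.isLITAlgebra {𝒳 : Set (FGModuleCat.{u} Λ)} (h : IsLeftSaturated 𝒳)
    (hphi : phiDim 𝒳 = 0) {n : ℕ} (hres : resdimClass 𝒳 (Set.range (syzygy^[n])) ≤ 1) :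
    IsLITAlgebra Λ n (FGModuleCat.of Λ PUnit.{u + 1}) 𝒳 where
  add_eq := h.addClosure_eq
  syzygy_subset := by
    rintro _ ⟨M, hM, rfl⟩
    exact h.syzygy_mem hM
  phiDim_eq_zero := hphi
  exists_exact M := by
    obtain ⟨X₁, h₁, X₀, h₀, f, g, hs⟩ := exists_isShortExact_of_resdim_le_one h
      ((le_iSup₂ (f := fun Y (_ : Y ∈ Set.range (syzygy^[n])) => resdim 𝒳 Y) _ ⟨M, rfl⟩).trans
        hres)
    have hV := subset_addClosure {FGModuleCat.of Λ PUnit.{u + 1}} rfl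
    refine ⟨_, hV, _, hV, X₁, h₁, X₀, h₀, LinearMap.id.prodMap f,
      g ∘ₗ LinearMap.snd Λ _ _, injective_id.prodMap hs.injective, ?_,
      hs.surjective.comp LinearMap.snd_surjective⟩
    rintro ⟨⟨⟩, x⟩
    refine (hs.exact x).trans ⟨?_, ?_⟩
    · rintro ⟨y, rfl⟩
      exact ⟨(PUnit.unit, y), rfl⟩
    · rintro ⟨y, hy⟩
      exact ⟨y.2, congrArg Prod.snd hy⟩

theorem IsLeftSaturated.finDim_le {𝒳 : Set (FGModuleCat.{u} Λ)} (h : IsLeftSaturated 𝒳)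
    (hphi : phiDim 𝒳 = 0) {n : ℕ} (hres : resdimClass 𝒳 (Set.range (syzygy^[n])) ≤ 1) :
    finDim Λ ≤ n + 1 := by
  refine iSup₂_le fun M hM => ?_
  obtain ⟨k, hk⟩ := (projectiveDimension_ne_top_iff _).mp hM
  obtain ⟨X₁, h₁, X₀, h₀, f, g, hs⟩ := exists_isShortExact_of_resdim_le_one h
    ((le_iSup₂ (f := fun Y (_ : Y ∈ Set.range (syzygy^[n])) => resdim 𝒳 Y) _ ⟨M, rfl⟩).trans
      hres)
  obtain ⟨K, hK, P, i, p, hP, hp⟩ := h.exists_isShortExact_projective h₁ h₀ hs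
  have hP' := (IsProjective.iff_projective P).mp hP
  -- The bound on pd M is weakened to fit the shape required for passing to the n-th syzygy; only
  -- its finiteness matters.
  have hN : HasProjectiveDimensionLT (syzygy^[n] M).obj (k + 2) := by
    rw [← hasProjectiveDimensionLT_iterate_syzygy_iff]
    exact hasProjectiveDimensionLT_of_ge _ (k + 1) _ (by omega)
  have hKproj := projective_of_phiDim_eq_zero hphi hK
    ((hp.shortExact.hasProjectiveDimensionLT_X₃_iff k hP').mp hN)
  have hN' : HasProjectiveDimensionLT (syzygy^[n] M).obj 2 :=
    (hp.shortExact.hasProjectiveDimensionLT_X₃_iff 0 hP').mpr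
      (hasProjectiveDimensionLT_one_iff.mpr hKproj)
  have hM' := hasProjectiveDimensionLT_iterate_syzygy_iff (k := 1).mpr hN'
  exact_mod_cast (projectiveDimension_le_iff M.obj (n + 1)).mpr hM'

end LIT

/-! ### Gorenstein projective modules are left saturated. -/

section Gproj

variable {Λ : Type u} [Ring Λ]

variable (Λ) in
/-- `Ext^i(M, Q) = 0` for all `i ≥ 1` and all finitely generated projective modules `Q`. -/
def ExtOrthogonal (M : Type u) [AddCommGroup M] [Module Λ M] : Prop :=
  ∀ Q : FGModuleCat.{u} Λ, Module.Projective Λ Q → ∀ i, ExtVanishes Λ M Q (i + 1)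

/-- Every module in the class is `Ext`-orthogonal to the projectives, and embeds into a finitely
generated projective module with cokernel in the class. -/
def IsCosyzygyClass (𝒞 : Set (FGModuleCat.{u} Λ)) : Prop :=
  ∀ M ∈ 𝒞, ExtOrthogonal Λ M ∧ ∃ (P : FGModuleCat.{u} Λ), ∃ M' ∈ 𝒞,
    ∃ (i : M →ₗ[Λ] P) (p : P →ₗ[Λ] M'), Module.Projective Λ P ∧ IsShortExact i p

theorem extOrthogonal_of_projective {M : Type u} [AddCommGroup M] [Module Λ M]
    [Module.Projective Λ M] : ExtOrthogonal Λ M :=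
  fun _ _ i => extVanishes_of_projective i

theorem ExtOrthogonal.of_projective_middle {A B C : Type u} [AddCommGroup A] [AddCommGroup B]
    [AddCommGroup C] [Module Λ A] [Module Λ B] [Module Λ C] {f : A →ₗ[Λ] B} {g : B →ₗ[Λ] C}
    [Module.Projective Λ B] (h : IsShortExact f g) (hC : ExtOrthogonal Λ C) :
    ExtOrthogonal Λ A :=
  fun Q hQ i => ExtVanishes.left h (extVanishes_of_projective i) (hC Q hQ (i + 1))

/-- A module with a doubly infinite sequence of syzygies and cosyzygies orthogonal to the
projectives is Gorenstein projective. -/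
theorem mem_Gproj_of_int {Z : ℤ → FGModuleCat.{u} Λ}
    (hZ : ∀ m, ExtOrthogonal Λ (Z m)) (hs : ∀ m : ℤ, ∃ (P : FGModuleCat.{u} Λ)
      (i : Z (m + 1) →ₗ[Λ] P) (p : P →ₗ[Λ] Z m), Module.Projective Λ P ∧ IsShortExact i p)
    -- The differential is P (m + 1) → Z (m + 1) → P m, so ker (d 0) = ker (p 1) = im (i 1) ≅ Z 2.
    {M : FGModuleCat.{u} Λ} (e : M ≃ₗ[Λ] Z (0 + 1 + 1)) : M ∈ Gproj Λ := by
  choose P i p hP hip using hs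
  refine ⟨P, fun m => i m ∘ₗ p (m + 1), hP, fun m => ?_, fun Q hQ m => ?_, ?_⟩
  · intro x
    change i m (p (m + 1) x) = 0 ↔ ∃ y, i (m + 1) (p (m + 1 + 1) y) = x
    rw [map_eq_zero_iff _ (hip m).injective, (hip (m + 1)).exact]
    constructor
    · rintro ⟨y, rfl⟩
      obtain ⟨z, rfl⟩ := (hip (m + 1 + 1)).surjective y
      exact ⟨z, rfl⟩
    · rintro ⟨y, rfl⟩
      exact ⟨_, rfl⟩
  · intro φ
    change φ ∘ₗ (i (m + 1) ∘ₗ p (m + 1 + 1)) = 0 ↔ ∃ ψ : P m →ₗ[Λ] Q, ψ ∘ₗ i m ∘ₗ p (m + 1) = φ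
    constructor
    · intro h
      have hker : LinearMap.ker (p (m + 1)) ≤ LinearMap.ker φ := by
        intro x hx
        obtain ⟨y, rfl⟩ := ((hip (m + 1)).exact x).mp hx
        obtain ⟨z, rfl⟩ := (hip (m + 1 + 1)).surjective y
        exact LinearMap.congr_fun h z
      obtain ⟨ψ, hψ⟩ := exists_factor_of_ker_le (hip (m + 1)).surjective hker
      obtain ⟨χ, hχ⟩ := ExtVanishes.exists_extension (hip m) (hZ m Q hQ 0) ψ
      refine ⟨χ, ?_⟩
      rw [← LinearMap.comp_assoc, hχ]
      ext x
      exact hψ x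
    · rintro ⟨ψ, rfl⟩
      ext x
      change ψ (i m (p (m + 1) (i (m + 1) (p (m + 1 + 1) x)))) = 0
      rw [(hip (m + 1)).exact.apply_apply_eq_zero, map_zero, map_zero]
  · refine ⟨e ≪≫ₗ LinearEquiv.ofInjective (i (0 + 1)) (hip (0 + 1)).injective ≪≫ₗ
      LinearEquiv.ofEq _ _ ?_⟩
    ext x
    change (x ∈ Set.range (i (0 + 1))) ↔ i 0 (p (0 + 1) x) = 0
    rw [map_eq_zero_iff _ (hip 0).injective]
    exact ((hip (0 + 1)).exact x).symm

variable (Λ) in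
/-- The modules isomorphic to any of the cycle modules of an acyclic complex of finitely generated
projective modules which stays acyclic under `Hom(-, Q)` for every finitely generated projective
`Q`. -/
def totallyAcyclicCycles : Set (FGModuleCat.{u} Λ) :=
  {M | ∃ (P : ℤ → FGModuleCat.{u} Λ) (d : ∀ m : ℤ, P (m + 1) →ₗ[Λ] P m),
    (∀ m, Module.Projective Λ (P m)) ∧
    (∀ m, Exact (d (m + 1)) (d m)) ∧
    (∀ Q : FGModuleCat.{u} Λ, Module.Projective Λ Q → ∀ m : ℤ,
      Exact (fun φ : P m →ₗ[Λ] Q => φ ∘ₗ d m)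
        (fun φ : P (m + 1) →ₗ[Λ] Q => φ ∘ₗ d (m + 1))) ∧
    ∃ m, Nonempty (M ≃ₗ[Λ] LinearMap.ker (d m))}

/-- Acyclicity of Hom(P, Q) says that maps from cycles to Q extend to the ambient projective, so
Ext¹ vanishes on all cycles; dimension shifting along the complex gives the higher Ext. The next
cycle is the cosyzygy. -/
theorem isCosyzygyClass_totallyAcyclicCycles [IsNoetherianRing Λ] :
    IsCosyzygyClass (totallyAcyclicCycles Λ) := by
  rintro M ⟨P, d, hP, hd, hQ, k, ⟨e⟩⟩
  have hdd : ∀ m x, d m (d (m + 1) x) = 0 := fun m x => (hd m).apply_apply_eq_zero x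
  have hs : ∀ m, IsShortExact (LinearMap.ker (d (m + 1))).subtype
      ((d (m + 1)).codRestrict (LinearMap.ker (d m)) (hdd m)) := by
    intro m
    refine ⟨Subtype.val_injective, fun x => ?_, fun ⟨x, hx⟩ => ?_⟩
    · constructor
      · intro h
        exact ⟨⟨x, congrArg Subtype.val h⟩, rfl⟩
      · rintro ⟨y, rfl⟩
        exact Subtype.ext y.2
    · obtain ⟨y, rfl⟩ := (hd m x).mp hx
      exact ⟨y, rfl⟩
  have hone : ∀ Q : FGModuleCat.{u} Λ, Module.Projective Λ Q → ∀ m,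
      ExtVanishes Λ (LinearMap.ker (d m)) Q 1 := by
    intro Q hQp m
    have := hP (m + 1 + 1)
    refine extVanishes_one_of_exists_extension (hs m) fun φ => ?_
    -- Composing φ with the surjection of P (m + 3) onto the cycles gives a cocycle; writing it as
    -- the coboundary of ψ makes ψ extend φ.
    obtain ⟨ψ, hψ⟩ := (hQ Q hQp (m + 1 + 1)
      (φ ∘ₗ (d (m + 1 + 1)).codRestrict _ (hdd (m + 1)))).mp (by
        ext x
        change φ _ = 0
        rw [← map_zero φ]
        exact congrArg φ (Subtype.ext (hdd _ x)))
    refine ⟨ψ, ?_⟩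
    ext x
    obtain ⟨y, rfl⟩ := (hs (m + 1)).surjective x
    exact LinearMap.congr_fun hψ y
  have horth : ∀ m, ExtOrthogonal Λ (LinearMap.ker (d m)) := by
    intro m Q hQp i
    induction i generalizing m with
    | zero => exact hone Q hQp m
    | succ i ih =>
      have := hP (m + 1 + 1)
      exact ExtVanishes.right (hs m) (ih (m + 1)) (extVanishes_of_projective (i + 1))
  refine ⟨fun Q hQp i => (horth k Q hQp i).of_retract (s := e.toLinearMap)
    (r := e.symm.toLinearMap) (by ext; simp), ?_⟩
  obtain ⟨m, rfl⟩ : ∃ m, k = m + 1 := ⟨k - 1, by omega⟩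
  exact ⟨P (m + 1 + 1), FGModuleCat.of Λ (LinearMap.ker (d m)),
    ⟨P, d, hP, hd, hQ, m, ⟨.refl _ _⟩⟩, _, _, hP _, (hs m).comp_equiv e⟩

/-- Iterated syzygies of M in one direction and chosen cosyzygies in the other form a doubly
infinite sequence. Cosyzygies stay in the class, and orthogonality passes to syzygies by dimension
shifting. -/
theorem IsCosyzygyClass.subset_Gproj [IsArtinianRing Λ] {𝒞 : Set (FGModuleCat.{u} Λ)}
    (h : IsCosyzygyClass 𝒞) : 𝒞 ⊆ Gproj Λ := by
  intro M hM
  have hc : ∀ M, ∃ M', M ∈ 𝒞 → M' ∈ 𝒞 ∧ ∃ (P : FGModuleCat.{u} Λ) (i : M →ₗ[Λ] P)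
      (p : P →ₗ[Λ] M'), Module.Projective Λ P ∧ IsShortExact i p := by
    intro M
    by_cases hM : M ∈ 𝒞
    · obtain ⟨-, P, M', hM', i, p, hP, hs⟩ := h M hM
      exact ⟨M', fun _ => ⟨hM', P, i, p, hP, hs⟩⟩
    · exact ⟨M, fun h => absurd h hM⟩
  choose σ hσ using hc
  have hmem : ∀ k, σ^[k] M ∈ 𝒞 := by
    intro k
    induction k with
    | zero => exact hM
    | succ k ih =>
      rw [iterate_succ_apply']
      exact (hσ _ ih).1
  let Z : ℤ → FGModuleCat.{u} Λ
    | Int.ofNat k => syzygy^[k] M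
    | Int.negSucc k => σ^[k + 1] M
  have hs : ∀ m : ℤ, ∃ (P : FGModuleCat.{u} Λ) (i : Z (m + 1) →ₗ[Λ] P) (p : P →ₗ[Λ] Z m),
      Module.Projective Λ P ∧ IsShortExact i p := by
    rintro (k | k)
    · have hk := exists_isShortExact_syzygy (syzygy^[k] M)
      rw [← iterate_succ_apply' syzygy] at hk
      exact hk
    · have hk := (hσ _ (hmem k)).2
      rw [← iterate_succ_apply' σ] at hk
      cases k with
      | zero => exact hk
      | succ k => exact hk
  have hZ : ∀ m, ExtOrthogonal Λ (Z m) := by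
    rintro (k | k)
    · induction k with
      | zero => exact (h M hM).1
      | succ k ih =>
        obtain ⟨P, i, p, hP, hs⟩ := hs (Int.ofNat k)
        exact ih.of_projective_middle hs
    · exact (h _ (hmem (k + 1))).1
  -- The shift by 2 moves M = Z 0 to the position that becomes ker (d 0).
  refine mem_Gproj_of_int (Z := fun m => Z (m - 2)) (fun m => hZ _) (fun m => ?_) ?_
  swap
  · rw [show (0 + 1 + 1 - 2 : ℤ) = 0 from rfl]
    exact .refl Λ M
  have hm : m + 1 - 2 = m - 2 + 1 := by ring
  rw [hm]
  exact hs (m - 2)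

/-- Allowing cycles in every degree makes closure under cosyzygies immediate; coinduction then
returns to degree 0 without reindexing a complex. -/
theorem Gproj_eq_totallyAcyclicCycles [IsArtinianRing Λ] : Gproj Λ = totallyAcyclicCycles Λ :=
  Set.Subset.antisymm (fun _ ⟨P, d, hP, hd, hQ, e⟩ => ⟨P, d, hP, hd, hQ, 0, e⟩)
    isCosyzygyClass_totallyAcyclicCycles.subset_Gproj

theorem isCosyzygyClass_Gproj [IsArtinianRing Λ] : IsCosyzygyClass (Gproj Λ) := by
  rw [Gproj_eq_totallyAcyclicCycles]
  exact isCosyzygyClass_totallyAcyclicCycles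

theorem ExtOrthogonal.extension {A B C : Type u} [AddCommGroup A] [AddCommGroup B]
    [AddCommGroup C] [Module Λ A] [Module Λ B] [Module Λ C] {f : A →ₗ[Λ] B} {g : B →ₗ[Λ] C}
    (h : IsShortExact f g) (hA : ExtOrthogonal Λ A) (hC : ExtOrthogonal Λ C) :
    ExtOrthogonal Λ B :=
  fun Q hQ i => ExtVanishes.middle h (hA Q hQ i) (hC Q hQ i)

theorem mem_Gproj_of_projective [IsArtinianRing Λ] {P : FGModuleCat.{u} Λ}
    (hP : Module.Projective Λ P) : P ∈ Gproj Λ := by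
  have h : IsCosyzygyClass {P : FGModuleCat.{u} Λ | Module.Projective Λ P} := by
    intro P (hP : Module.Projective Λ P)
    refine ⟨extOrthogonal_of_projective, P, FGModuleCat.of Λ PUnit.{u + 1},
      inferInstanceAs (Module.Projective Λ PUnit.{u + 1}), LinearMap.id, 0, hP, injective_id,
      fun x => ⟨fun _ => ⟨x, rfl⟩, fun _ => rfl⟩, fun x => ⟨0, rfl⟩⟩
  exact h.subset_Gproj hP

/-- A dual horseshoe argument: as Ext¹(C, P) = 0, the embedding A → P extends to B, and with C → Q
it embeds B in P ⊕ Q. The cokernel is an extension of C' by A', so extensions form a cosyzygy class.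
-/
theorem mem_Gproj_of_extension [IsArtinianRing Λ] {A B C : FGModuleCat.{u} Λ} {f : A →ₗ[Λ] B}
    {g : B →ₗ[Λ] C} (h : IsShortExact f g) (hA : A ∈ Gproj Λ) (hC : C ∈ Gproj Λ) :
    B ∈ Gproj Λ := by
  have hclass : IsCosyzygyClass {B : FGModuleCat.{u} Λ | ∃ A ∈ Gproj Λ, ∃ C ∈ Gproj Λ,
      ∃ (f : A →ₗ[Λ] B) (g : B →ₗ[Λ] C), IsShortExact f g} := by
    rintro B ⟨A, hA, C, hC, f, g, h⟩
    obtain ⟨hAo, P, A', hA', i, p, hP, hip⟩ := isCosyzygyClass_Gproj A hA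
    obtain ⟨hCo, Q, C', hC', j, q, hQ, hjq⟩ := isCosyzygyClass_Gproj C hC
    refine ⟨.extension h hAo hCo, ?_⟩
    obtain ⟨ψ, hψ⟩ := ExtVanishes.exists_extension h (hCo P hP 0) i
    replace hψ : ∀ a, ψ (f a) = i a := fun a => LinearMap.congr_fun hψ a
    let k : B →ₗ[Λ] P × Q := ψ.prod (j ∘ₗ g)
    let r := (LinearMap.range k).mkQ
    have hr : ∀ x, r x = 0 ↔ ∃ b, k b = x := fun x =>
      (Submodule.Quotient.mk_eq_zero _).trans LinearMap.mem_range
    have hrs : Surjective r := Submodule.mkQ_surjective _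
    have hk : Injective k := by
      rw [injective_iff_map_eq_zero]
      intro b hb
      obtain ⟨a, rfl⟩ := (h.exact b).mp
        ((map_eq_zero_iff j hjq.injective).mp (congrArg Prod.snd hb))
      have ha : ψ (f a) = 0 := congrArg Prod.fst hb
      rw [hψ, map_eq_zero_iff i hip.injective] at ha
      rw [ha, map_zero]
    obtain ⟨α, hα⟩ := exists_factor_of_ker_le hip.surjective (g := r ∘ₗ LinearMap.inl Λ P Q) (by
      intro x hx
      obtain ⟨a, rfl⟩ := (hip.exact x).mp hx
      exact (hr _).mpr ⟨f a, Prod.ext (hψ a)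
        ((congrArg j (h.exact.apply_apply_eq_zero a)).trans (map_zero j))⟩)
    obtain ⟨β, hβ⟩ := exists_factor_of_ker_le hrs (g := q ∘ₗ LinearMap.snd Λ P Q) (by
      intro x hx
      obtain ⟨b, rfl⟩ := (hr x).mp hx
      exact hjq.exact.apply_apply_eq_zero _)
    refine ⟨FGModuleCat.of Λ (P × Q), FGModuleCat.of Λ ((P × Q) ⧸ LinearMap.range k),
      ⟨A', hA', C', hC', α, β, ?_, ?_, ?_⟩, k, r, inferInstanceAs (Module.Projective Λ (P × Q)),
      hk, hr, hrs⟩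
    · rw [injective_iff_map_eq_zero]
      intro x hx
      obtain ⟨y, rfl⟩ := hip.surjective x
      rw [hα] at hx
      obtain ⟨b, hb⟩ := (hr _).mp hx
      obtain ⟨a, rfl⟩ := (h.exact b).mp
        ((map_eq_zero_iff j hjq.injective).mp (congrArg Prod.snd hb))
      exact (hip.exact y).mpr ⟨a, (hψ a).symm.trans (congrArg Prod.fst hb)⟩
    · intro z
      obtain ⟨⟨x, y⟩, rfl⟩ := hrs z
      rw [hβ]
      constructor
      · intro hy
        obtain ⟨c, hc⟩ := (hjq.exact y).mp hy
        obtain ⟨b, rfl⟩ := h.surjective c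
        refine ⟨p (x - ψ b), ?_⟩
        rw [hα, LinearMap.comp_apply, ← sub_eq_zero, ← map_sub, hr]
        exact ⟨-b, by simp [k, ← hc]⟩
      · rintro ⟨w, hw⟩
        obtain ⟨v, rfl⟩ := hip.surjective w
        rw [hα] at hw
        rw [← hβ, ← hw, LinearMap.comp_apply, hβ]
        simp
    · intro c
      obtain ⟨y, rfl⟩ := hjq.surjective c
      exact ⟨r (0, y), hβ _⟩
  exact hclass.subset_Gproj ⟨A, hA, C, hC, f, g, h⟩

/-- Embed M in P through X ≅ M ⊕ N. Adding the identity of M to 0 → N → P/M → X' → 0 yields 0 → X →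
P/M ⊕ M → X' → 0. So P/M ⊕ M is Gorenstein projective, and the cosyzygy P/M is again a summand of
such a module. -/
theorem mem_Gproj_of_summand [IsArtinianRing Λ] {M N X : FGModuleCat.{u} Λ}
    (e : (M × N) ≃ₗ[Λ] X) (hX : X ∈ Gproj Λ) : M ∈ Gproj Λ := by
  have hclass : IsCosyzygyClass {M : FGModuleCat.{u} Λ | ∃ N : FGModuleCat.{u} Λ,
      ∃ X ∈ Gproj Λ, Nonempty ((M × N) ≃ₗ[Λ] X)} := by
    rintro M ⟨N, X, hX, ⟨e⟩⟩
    obtain ⟨hXo, P, X', hX', i, p, hP, hip⟩ := isCosyzygyClass_Gproj X hX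
    refine ⟨fun Q hQ k => (hXo Q hQ k).of_retract
      (s := e.toLinearMap ∘ₗ LinearMap.inl Λ M N)
      (r := LinearMap.fst Λ M N ∘ₗ e.symm.toLinearMap) (by ext; simp), ?_⟩
    let k : M →ₗ[Λ] P := i ∘ₗ e.toLinearMap ∘ₗ LinearMap.inl Λ M N
    have hkapp : ∀ m, k m = i (e (m, 0)) := fun _ => rfl
    let r := (LinearMap.range k).mkQ
    have hr : ∀ x, r x = 0 ↔ ∃ b, k b = x := fun x =>
      (Submodule.Quotient.mk_eq_zero _).trans LinearMap.mem_range
    have hrs : Surjective r := Submodule.mkQ_surjective _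
    have hk : Injective k :=
      hip.injective.comp (e.injective.comp LinearMap.inl_injective)
    obtain ⟨γ, hγ⟩ := exists_factor_of_ker_le hrs (g := p) (by
      intro x hx
      obtain ⟨m, rfl⟩ := (hr x).mp hx
      exact hip.exact.apply_apply_eq_zero _)
    let a : X →ₗ[Λ] (P ⧸ LinearMap.range k) × M :=
      (r ∘ₗ i).prod (LinearMap.fst Λ M N ∘ₗ e.symm.toLinearMap)
    have ha : ∀ m n, a (e (m, n)) = (r (i (e (m, n))), m) := fun m n => by simp [a]
    have hs : IsShortExact a (γ ∘ₗ LinearMap.fst Λ (P ⧸ LinearMap.range k) M) := by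
      refine ⟨?_, ?_, ?_⟩
      · rw [injective_iff_map_eq_zero]
        intro x hx
        obtain ⟨⟨m, n⟩, rfl⟩ := e.surjective x
        rw [ha, Prod.mk_eq_zero, hr] at hx
        obtain ⟨⟨m', hm'⟩, rfl⟩ := hx
        have h0 := e.injective (hip.injective ((hkapp m').symm.trans hm'))
        rw [show n = 0 from (congrArg Prod.snd h0).symm]
        exact map_zero e
      · rintro ⟨z, m⟩
        obtain ⟨y, rfl⟩ := hrs z
        change γ (r y) = 0 ↔ _
        rw [hγ, hip.exact]
        constructor
        · rintro ⟨x, rfl⟩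
          obtain ⟨⟨m', n⟩, rfl⟩ := e.surjective x
          refine ⟨e (m, n), ?_⟩
          rw [ha]
          refine Prod.ext ?_ rfl
          change r _ = r _
          rw [← sub_eq_zero, ← map_sub, hr]
          refine ⟨m - m', ?_⟩
          rw [hkapp, ← map_sub, ← map_sub]
          simp
        · rintro ⟨x, hx⟩
          have h1 : r (i x) = r y := congrArg Prod.fst hx
          rw [← hip.exact, ← hγ, ← h1, hγ, hip.exact.apply_apply_eq_zero]
      · intro x
        obtain ⟨y, rfl⟩ := hip.surjective x
        exact ⟨(r y, 0), hγ y⟩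
    exact ⟨P, FGModuleCat.of Λ (P ⧸ LinearMap.range k), ⟨M,
      FGModuleCat.of Λ ((P ⧸ LinearMap.range k) × M), mem_Gproj_of_extension hs hX hX',
      ⟨.refl _ _⟩⟩, k, r, hP, hk, hr, hrs⟩
  exact hclass.subset_Gproj ⟨N, X, hX, ⟨e⟩⟩

/-- Adjoining A to Gproj leaves a cosyzygy class, with C as the cosyzygy of A. -/
theorem mem_Gproj_of_projective_middle [IsArtinianRing Λ] {A P C : FGModuleCat.{u} Λ}
    {f : A →ₗ[Λ] P} {g : P →ₗ[Λ] C} (hP : Module.Projective Λ P) (h : IsShortExact f g)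
    (hC : C ∈ Gproj Λ) : A ∈ Gproj Λ := by
  have hclass : IsCosyzygyClass (insert A (Gproj Λ)) := by
    rintro M (rfl | hM)
    · exact ⟨(isCosyzygyClass_Gproj C hC).1.of_projective_middle h,
        P, C, Or.inr hC, f, g, hP, h⟩
    · obtain ⟨hMo, P, M', hM', hs⟩ := isCosyzygyClass_Gproj M hM
      exact ⟨hMo, P, M', Or.inr hM', hs⟩
  exact hclass.subset_Gproj (Or.inl rfl)

/-- Lifting a projective cover P → C to B gives 0 → Ω C → A ⊕ P → B → 0. Hence A ⊕ P is Gorenstein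
projective, and A is a summand. -/
theorem mem_Gproj_of_kernel [IsArtinianRing Λ] {A B C : FGModuleCat.{u} Λ} {f : A →ₗ[Λ] B}
    {g : B →ₗ[Λ] C} (h : IsShortExact f g) (hB : B ∈ Gproj Λ) (hC : C ∈ Gproj Λ) :
    A ∈ Gproj Λ := by
  obtain ⟨P, i, p, hP, hip⟩ := exists_isShortExact_syzygy C
  obtain ⟨s, hs⟩ := Module.projective_lifting_property g p h.surjective
  replace hs : ∀ x, g (s x) = p x := fun x => LinearMap.congr_fun hs x
  obtain ⟨t, ht⟩ := exists_factor_of_range_le h.injective (g := s ∘ₗ i) fun x =>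
    (h.exact _).mp ((hs _).trans (hip.exact.apply_apply_eq_zero x))
  have hE : IsShortExact ((-t).prod i) (f.coprod s) := by
    refine ⟨fun x y hxy => hip.injective (congrArg Prod.snd hxy), ?_, fun b => ?_⟩
    · rintro ⟨a, x⟩
      constructor
      · intro hax
        replace hax : f a + s x = 0 := hax
        have hx : p x = 0 := by
          have hgx := congrArg g hax
          rwa [map_add, h.exact.apply_apply_eq_zero, zero_add, hs, map_zero] at hgx
        obtain ⟨y, rfl⟩ := (hip.exact x).mp hx
        refine ⟨y, Prod.ext (h.injective ?_) rfl⟩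
        change f (-t y) = f a
        rw [map_neg, ht]
        exact (eq_neg_of_add_eq_zero_left hax).symm
      · rintro ⟨y, hy⟩
        rw [← hy]
        simp [ht]
    · obtain ⟨x, hx⟩ := hip.surjective (g b)
      obtain ⟨a, ha⟩ := (h.exact (b - s x)).mp (by rw [map_sub, hs, hx, sub_self])
      exact ⟨(a, x), by simp [ha]⟩
  exact mem_Gproj_of_summand (N := P) (X := FGModuleCat.of Λ (A × P)) (.refl _ _)
    (mem_Gproj_of_extension hE (mem_Gproj_of_projective_middle hP hip hC) hB)

theorem isLeftSaturated_Gproj [IsArtinianRing Λ] : IsLeftSaturated (Gproj Λ) where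
  extension _ _ _ _ _ hf hfg hg := mem_Gproj_of_extension ⟨hf, hfg, hg⟩
  kernel _ _ _ _ _ hf hfg hg := mem_Gproj_of_kernel ⟨hf, hfg, hg⟩
  projective _ hP := mem_Gproj_of_projective hP
  summand _ _ _ := fun ⟨e⟩ hX => mem_Gproj_of_summand e hX

end Gproj

/-! ### A left inverse of L on Gorenstein projectives. -/

section Cosyzygy

variable {Λ : Type u} [Ring Λ]

/-- The cokernel sequence `M → P → C → 0` of a left approximation of `M` by finitely generated
projective modules. -/
structure IsApproximation {M P C : FGModuleCat.{u} Λ} (f : M →ₗ[Λ] P) (g : P →ₗ[Λ] C) : Prop where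
  projective : Module.Projective Λ P
  exact : Exact f g
  surjective : Surjective g
  exists_extension : ∀ Q : FGModuleCat.{u} Λ, Module.Projective Λ Q → ∀ φ : M →ₗ[Λ] Q,
    ∃ ψ : P →ₗ[Λ] Q, ∀ x, ψ (f x) = φ x

/-- A dual Schanuel argument: C ⊕ P' and C' ⊕ P are both the cokernel of M → P ⊕ P'. Neither
approximation need be injective or minimal. -/
theorem IsApproximation.stableClass_eq {M P C M' P' C' : FGModuleCat.{u} Λ} {f : M →ₗ[Λ] P}
    {g : P →ₗ[Λ] C} {f' : M' →ₗ[Λ] P'} {g' : P' →ₗ[Λ] C'} (h : IsApproximation f g)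
    (h' : IsApproximation f' g') (e : M ≃ₗ[Λ] M') : stableClass C = stableClass C' := by
  obtain ⟨a, ha⟩ := h.exists_extension P' h'.projective (f' ∘ₗ e.toLinearMap)
  obtain ⟨b, hb⟩ := h'.exists_extension P h.projective (f ∘ₗ e.symm.toLinearMap)
  let k : (P × P') →ₗ[Λ] C × P' :=
    (g ∘ₗ LinearMap.fst Λ P P').prod (LinearMap.snd Λ P P' - a ∘ₗ LinearMap.fst Λ P P')
  let k' : (P × P') →ₗ[Λ] C' × P :=
    (g' ∘ₗ LinearMap.snd Λ P P').prod (LinearMap.fst Λ P P' - b ∘ₗ LinearMap.snd Λ P P')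
  have hk : Surjective k := by
    rintro ⟨c, y⟩
    obtain ⟨x, rfl⟩ := h.surjective c
    exact ⟨(x, y + a x), by simp [k]⟩
  have hk' : Surjective k' := by
    rintro ⟨c, x⟩
    obtain ⟨y, rfl⟩ := h'.surjective c
    exact ⟨(x + b y, y), by simp [k']⟩
  have hker : LinearMap.ker k = LinearMap.ker k' := by
    ext ⟨x, y⟩
    have h1 : (x, y) ∈ LinearMap.ker k ↔ ∃ m, f m = x ∧ f' (e m) = y := by
      change ((g x, y - a x) : C × P') = 0 ↔ _
      rw [Prod.mk_eq_zero, h.exact, sub_eq_zero]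
      constructor
      · rintro ⟨⟨m, rfl⟩, rfl⟩
        exact ⟨m, rfl, (ha m).symm⟩
      · rintro ⟨m, rfl, rfl⟩
        exact ⟨⟨m, rfl⟩, (ha m).symm⟩
    have h2 : (x, y) ∈ LinearMap.ker k' ↔ ∃ m, f m = x ∧ f' (e m) = y := by
      change ((g' y, x - b y) : C' × P) = 0 ↔ _
      rw [Prod.mk_eq_zero, h'.exact, sub_eq_zero]
      constructor
      · rintro ⟨⟨m, rfl⟩, rfl⟩
        exact ⟨e.symm m, by simp [hb]⟩
      · rintro ⟨m, rfl, rfl⟩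
        exact ⟨⟨e m, rfl⟩, by simp [hb]⟩
    rw [h1, h2]
  obtain ⟨E⟩ := nonempty_equiv_of_ker_eq hk hk' hker
  have h3 := stableClass_prod (M := FGModuleCat.of Λ (C × P')) (.refl Λ (C × P'))
  have h4 := stableClass_prod (M := FGModuleCat.of Λ (C × P')) E
  rw [stableClass_projective h'.projective, add_zero] at h3
  rw [stableClass_projective h.projective, add_zero] at h4
  exact h3.symm.trans h4

theorem IsApproximation.prod {M P C M' P' C' : FGModuleCat.{u} Λ} {f : M →ₗ[Λ] P}
    {g : P →ₗ[Λ] C} {f' : M' →ₗ[Λ] P'} {g' : P' →ₗ[Λ] C'} (h : IsApproximation f g)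
    (h' : IsApproximation f' g') :
    IsApproximation (M := FGModuleCat.of Λ (M × M')) (P := FGModuleCat.of Λ (P × P'))
      (C := FGModuleCat.of Λ (C × C')) (f.prodMap f') (g.prodMap g') where
  projective := by
    have := h.projective
    have := h'.projective
    exact inferInstanceAs (Module.Projective Λ (P × P'))
  exact := by
    rintro ⟨x, y⟩
    change ((g x, g' y) : C × C') = 0 ↔ _
    rw [Prod.mk_eq_zero, h.exact, h'.exact]
    constructor
    · rintro ⟨⟨m, rfl⟩, ⟨m', rfl⟩⟩
      exact ⟨(m, m'), rfl⟩
    · rintro ⟨⟨m, m'⟩, hm⟩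
      exact ⟨⟨m, congrArg Prod.fst hm⟩, ⟨m', congrArg Prod.snd hm⟩⟩
  surjective := h.surjective.prodMap h'.surjective
  exists_extension Q hQ φ := by
    obtain ⟨ψ, hψ⟩ := h.exists_extension Q hQ (φ ∘ₗ LinearMap.inl Λ M M')
    obtain ⟨ψ', hψ'⟩ := h'.exists_extension Q hQ (φ ∘ₗ LinearMap.inr Λ M M')
    refine ⟨ψ.coprod ψ', ?_⟩
    rintro ⟨x, y⟩
    change ψ (f x) + ψ' (f' y) = φ (x, y)
    rw [hψ, hψ', LinearMap.comp_apply, LinearMap.comp_apply, ← map_add]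
    simp

theorem isApproximation_id {P : FGModuleCat.{u} Λ} (hP : Module.Projective Λ P) :
    IsApproximation (C := FGModuleCat.of Λ PUnit.{u + 1}) (LinearMap.id : P →ₗ[Λ] P) 0 where
  projective := hP
  exact x := ⟨fun _ => ⟨x, rfl⟩, fun _ => rfl⟩
  surjective _ := ⟨0, rfl⟩
  exists_extension _ _ φ := ⟨φ, fun _ => rfl⟩

theorem IsShortExact.isApproximation {M P C : FGModuleCat.{u} Λ} {f : M →ₗ[Λ] P}
    {g : P →ₗ[Λ] C} (h : IsShortExact f g) (hP : Module.Projective Λ P)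
    (hC : ExtOrthogonal Λ C) : IsApproximation f g where
  projective := hP
  exact := h.exact
  surjective := h.surjective
  exists_extension Q hQ φ := by
    obtain ⟨ψ, hψ⟩ := ExtVanishes.exists_extension h (hC Q hQ 0) φ
    exact ⟨ψ, fun x => LinearMap.congr_fun hψ x⟩

/-- Over an Artin algebra finitely many functionals on a finitely generated module generate all of
them. -/
theorem exists_generating_functionals [IsArtinAlgebra Λ] (M : FGModuleCat.{u} Λ) :
    ∃ (l : ℕ) (f : M →ₗ[Λ] (Fin l → Λ)), ∀ φ : M →ₗ[Λ] Λ, ∃ ψ : (Fin l → Λ) →ₗ[Λ] Λ,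
      ∀ x, ψ (f x) = φ x := by
  obtain ⟨R, _, _, _, _⟩ := IsArtinAlgebra.exists_base (Λ := Λ)
  obtain ⟨k, π, hπ⟩ := Module.Finite.exists_fin' Λ M
  -- Evaluation at generators embeds Hom(M, Λ) in the Noetherian R-module Λᵏ. This uses the central
  -- base ring R, not just that Λ is Artinian.
  let ev : (M →ₗ[Λ] Λ) →ₗ[R] (Fin k → Λ) :=
    { toFun := fun φ j => φ (π (Pi.single j 1))
      map_add' := fun _ _ => rfl
      map_smul' := fun _ _ => rfl }
  have hev : Injective ev := by
    intro φ φ' h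
    have h1 : φ ∘ₗ π = φ' ∘ₗ π :=
      LinearMap.pi_ext' fun j => LinearMap.ext_ring (congrFun h j)
    ext x
    obtain ⟨y, rfl⟩ := hπ x
    exact LinearMap.congr_fun h1 y
  have : IsNoetherian R (M →ₗ[Λ] Λ) := isNoetherian_of_injective ev hev
  obtain ⟨l, s, hs⟩ := Module.Finite.exists_fin (R := R) (M := M →ₗ[Λ] Λ)
  refine ⟨l, LinearMap.pi s, fun φ => ?_⟩
  have hφ : φ ∈ Submodule.span R (Set.range s) := by rw [hs]; trivial
  obtain ⟨c, hc⟩ := (Submodule.mem_span_range_iff_exists_fun R).mp hφ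
  refine ⟨∑ j, c j • LinearMap.proj j, fun x => ?_⟩
  simp [← hc, LinearMap.sum_apply]

theorem exists_isApproximation [IsArtinAlgebra Λ] (M : FGModuleCat.{u} Λ) :
    ∃ (P C : FGModuleCat.{u} Λ) (f : M →ₗ[Λ] P) (g : P →ₗ[Λ] C), IsApproximation f g := by
  obtain ⟨l, f, hf⟩ := exists_generating_functionals M
  refine ⟨FGModuleCat.of Λ (Fin l → Λ), FGModuleCat.of Λ ((Fin l → Λ) ⧸ LinearMap.range f), f,
    (LinearMap.range f).mkQ, inferInstanceAs (Module.Projective Λ (Fin l → Λ)),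
    LinearMap.exact_map_mkQ_range f, Submodule.mkQ_surjective _, fun Q hQ φ => ?_⟩
  obtain ⟨k, π, hπ⟩ := Module.Finite.exists_fin' Λ Q
  -- Q is a summand of a free module, so the coordinates of s ∘ φ can be extended one at a time.
  obtain ⟨s, hs⟩ := Module.projective_lifting_property π LinearMap.id hπ
  choose ψ hψ using fun j => hf (LinearMap.proj j ∘ₗ s ∘ₗ φ)
  refine ⟨π ∘ₗ LinearMap.pi ψ, fun x => ?_⟩
  have h1 : LinearMap.pi ψ (f x) = s (φ x) := funext fun j => hψ j x
  rw [LinearMap.comp_apply, h1]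
  exact LinearMap.congr_fun hs _

/-- The cokernel of a left approximation of `M` by finitely generated projective modules. -/
def approxCokernel [IsArtinAlgebra Λ] (M : FGModuleCat.{u} Λ) : FGModuleCat.{u} Λ :=
  (exists_isApproximation M).choose_spec.choose

theorem IsApproximation.stableClass_approxCokernel [IsArtinAlgebra Λ]
    {M P C M' : FGModuleCat.{u} Λ} {f : M →ₗ[Λ] P} {g : P →ₗ[Λ] C} (h : IsApproximation f g)
    (e : M' ≃ₗ[Λ] M) : stableClass (approxCokernel M') = stableClass C :=
  (exists_isApproximation M').choose_spec.choose_spec.choose_spec.choose_spec.stableClass_eq h e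

/-- The endomorphism of the Igusa–Todorov group sending `[M]` to the class of the cokernel of a left
approximation of `M` by finitely generated projective modules. -/
def stableCosyzygy [IsArtinAlgebra Λ] : StableGroup Λ →+ StableGroup Λ :=
  QuotientAddGroup.lift (AddSubgroup.closure (stableRelations Λ))
    (FreeAbelianGroup.lift fun M => stableClass (approxCokernel M)) <| by
      rw [AddSubgroup.closure_le]
      rintro x (⟨M, X, Y, ⟨e⟩, rfl⟩ | ⟨P, hP, rfl⟩)
      · obtain ⟨P, C, f, g, h⟩ := exists_isApproximation X
        obtain ⟨P', C', f', g', h'⟩ := exists_isApproximation Y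
        have h1 := (h.prod h').stableClass_approxCokernel e
        rw [stableClass_prod (M := FGModuleCat.of Λ (C × C')) (.refl Λ (C × C'))] at h1
        simp [AddMonoidHom.mem_ker, h1, h.stableClass_approxCokernel (.refl _ _),
          h'.stableClass_approxCokernel (.refl _ _)]
      · have h1 := (isApproximation_id hP).stableClass_approxCokernel (.refl _ _)
        rw [stableClass_projective (P := FGModuleCat.of Λ PUnit.{u + 1})
          (inferInstanceAs (Module.Projective Λ PUnit.{u + 1}))] at h1
        simpa [AddMonoidHom.mem_ker] using h1

theorem stableCosyzygy_stableClass [IsArtinAlgebra Λ] (M : FGModuleCat.{u} Λ) :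
    stableCosyzygy (stableClass M) = stableClass (approxCokernel M) := by
  exact FreeAbelianGroup.lift_apply_of _ _

variable [IsArtinAlgebra Λ]

/-- As Ext¹(M, Q) = 0 for projective Q, the inclusion of Ω M in its projective cover term is a left
approximation, with cokernel M. -/
theorem stableCosyzygy_stableSyzygy {M : FGModuleCat.{u} Λ} (hM : M ∈ Gproj Λ) :
    stableCosyzygy (stableSyzygy (stableClass M)) = stableClass M := by
  obtain ⟨P, i, p, hP, hs⟩ := exists_isShortExact_syzygy M
  rw [stableSyzygy_stableClass, stableCosyzygy_stableClass]
  exact (hs.isApproximation hP (isCosyzygyClass_Gproj M hM).1).stableClass_approxCokernel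
    (.refl _ _)

/-- The subgroup generated by all Gorenstein projective classes is L-stable, and `stableCosyzygy` is
a left inverse of L on its generators, hence on all of it by additivity. -/
theorem phiDim_Gproj : phiDim (Gproj Λ) = 0 := by
  refine le_antisymm (iSup₂_le fun X hX => le_of_eq ?_) zero_le
  refine fittingIndex_eq_zero (G := AddSubgroup.closure (stableClass '' Gproj Λ)) ?_ ?_ ?_
  · refine AddSubgroup.closure_mono (Set.image_mono ?_)
    exact (addClosure_mono (Set.singleton_subset_iff.mpr hX)).trans
      isLeftSaturated_Gproj.addClosure_eq.subset
  · have h : AddSubgroup.closure (stableClass '' Gproj Λ) ≤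
        (AddSubgroup.closure (stableClass '' Gproj Λ)).comap stableSyzygy := by
      rw [AddSubgroup.closure_le]
      rintro _ ⟨M, hM, rfl⟩
      refine AddSubgroup.subset_closure ⟨syzygy M, isLeftSaturated_Gproj.syzygy_mem hM, ?_⟩
      rw [stableSyzygy_stableClass]
    exact h
  · have h : Set.EqOn (stableCosyzygy.comp stableSyzygy) (AddMonoidHom.id (StableGroup Λ))
        (AddSubgroup.closure (stableClass '' Gproj Λ)) := by
      refine AddMonoidHom.eqOn_closure ?_
      rintro _ ⟨M, hM, rfl⟩
      exact stableCosyzygy_stableSyzygy hM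
    exact Set.LeftInvOn.injOn (f₁' := stableCosyzygy) fun x hx => h hx

end Cosyzygy

end ArtinAlg

end

theorem proposition5 (Λ : Type u) [Ring Λ] [IsArtinAlgebra Λ] (n : ℕ) :
    (∀ 𝒳 : Set (FGModuleCat.{u} Λ), IsLeftSaturated 𝒳 → phiDim 𝒳 = 0 →
      resdimClass 𝒳 (Set.range (syzygy^[n])) ≤ 1 →
        IsLITAlgebra Λ n (FGModuleCat.of Λ PUnit.{u + 1}) 𝒳 ∧ finDim Λ ≤ n + 1) ∧
    (resdimClass (Gproj Λ) (Set.range (syzygy^[n])) ≤ 1 →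
        IsLITAlgebra Λ n (FGModuleCat.of Λ PUnit.{u + 1}) (Gproj Λ) ∧ finDim Λ ≤ n + 1) := by
  exact ⟨fun _ h hphi hres => ⟨h.isLITAlgebra hphi hres, h.finDim_le hphi hres⟩, fun hres =>
    ⟨isLeftSaturated_Gproj.isLITAlgebra phiDim_Gproj hres,
      isLeftSaturated_Gproj.finDim_le phiDim_Gproj hres⟩⟩
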